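/- Let $0<\beta<1/2$ and $0\le\theta\le 1$. All functions are real-valued. For a function $w$ on $(0,1)$ put $$I^\beta_\theta w(x)=\frac{\theta}{\Gamma(\beta)}\int_0^x\frac{w(s)}{(x-s)^{1-\beta}}\,ds+\frac{1-\theta}{\Gamma(\beta)}\int_x^1\frac{w(s)}{(s-x)^{1-\beta}}\,ds .$$ Let $H^{1-\beta}_0(0,1)$ be the completion of $C_0^\infty(0,1)$ with respect to the norm $\|w\|=\bigl(\|w\|_{L^2(\mathbb R)}^2+\||\xi|^{1-\beta}\mathcal F w\|_{L^2(\mathbb R)}^2\bigr)^{1/2}$, where $\mathcal F$ is the Fourier transform; its elements are functions in $L^2(\mathbb R)$ that vanish a.e. outside $(0,1)$. Let $H^1(0,1)$ be the Sobolev space of all $w\in L^2(0,1)$ with weak derivative $Dw\in L^2(0,1)$, with the norm $(\|w\|_{L^2(0,1)}^2+\|Dw\|_{L^2(0,1)}^2)^{1/2}$. Then for every $\phi\in H^{1-\beta}_0(0,1)$ both integrals defining $I^\beta_\theta\phi(x)$ converge absolutely for every $x\in[0,1]$, and $I^\beta_\theta$ is a bounded linear operator from $H^{1-\beta}_0(0,1)$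 to $H^1(0,1)$. It is a bijection from $H^{1-\beta}_0(0,1)$ onto its range $$\mathcal R(I^\beta_\theta)=\{w\in H^1(0,1):\ \exists\,\phi\in H^{1-\beta}_0(0,1),\ w=I^\beta_\theta\phi\},$$ this range is a closed subspace of $H^1(0,1)$, and the inverse operator $(I^\beta_\theta)^{-1}:\mathcal R(I^\beta_\theta)\to H^{1-\beta}_0(0,1)$ is bounded. -/

import Mathlib

open MeasureTheory Set
open scoped FourierTransform ContDiff

noncomputable section

/-- The left Riemann-Liouville fractional integral of order `σ` based at `a`. -/
def leftFracInt (a σ : ℝ) (w : ℝ → ℝ) (x : ℝ) : ℝ :=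
  1 / Real.Gamma σ * ∫ s in a..x, w s / (x - s) ^ (1 - σ)

/-- The right Riemann-Liouville fractional integral of order `σ` based at `b`. -/
def rightFracInt (b σ : ℝ) (w : ℝ → ℝ) (x : ℝ) : ℝ :=
  1 / Real.Gamma σ * ∫ s in x..b, w s / (s - x) ^ (1 - σ)

/-- The two-sided fractional integral operator on `(a, b)`, acting on functions. -/
def twoSidedFracInt (a b θ σ : ℝ) (w : ℝ → ℝ) (x : ℝ) : ℝ :=
  θ * leftFracInt a σ w x + (1 - θ) * rightFracInt b σ w x

/-- `w ∈ C_0^∞(a, b)`: smooth on `ℝ`, with compact support contained in `(a, b)`. -/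
structure IsTestFunction (a b : ℝ) (w : ℝ → ℝ) : Prop where
  smooth : ContDiff ℝ ∞ w
  hasCompactSupport : HasCompactSupport w
  tsupport_subset : tsupport w ⊆ Ioo a b

theorem IsTestFunction.zero (a b : ℝ) : IsTestFunction a b 0 where
  smooth := contDiff_const
  hasCompactSupport := HasCompactSupport.zero
  tsupport_subset := by simp [tsupport]

theorem IsTestFunction.add {a b : ℝ} {w v : ℝ → ℝ} (hw : IsTestFunction a b w)
    (hv : IsTestFunction a b v) : IsTestFunction a b (w + v) where
  smooth := hw.smooth.add hv.smooth
  hasCompactSupport := hw.hasCompactSupport.add hv.hasCompactSupport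
  tsupport_subset := (tsupport_add w v).trans
    (union_subset hw.tsupport_subset hv.tsupport_subset)

theorem IsTestFunction.const_smul {a b : ℝ} {w : ℝ → ℝ} (c : ℝ) (hw : IsTestFunction a b w) :
    IsTestFunction a b (c • w) where
  smooth := contDiff_const.smul hw.smooth
  hasCompactSupport := hw.hasCompactSupport.smul_left (f := fun _ => c)
  tsupport_subset := (closure_mono (Function.support_const_smul_subset c w)).trans
    hw.tsupport_subset

theorem IsTestFunction.integrable_ofReal {a b : ℝ} {w : ℝ → ℝ} (hw : IsTestFunction a b w) :
    Integrable (fun x => (w x : ℂ)) :=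
  (hw.smooth.continuous.integrable_of_hasCompactSupport hw.hasCompactSupport).ofReal

/-- The space of pairs `(w, g)` in `L²(ℝ; ℝ) × L²(ℝ; ℂ)` with the norm
`(‖w‖² + ‖g‖²) ^ (1/2)`. -/
abbrev PairSpaceLine : Type :=
  WithLp 2 (Lp ℝ 2 (volume : Measure ℝ) × Lp ℂ 2 (volume : Measure ℝ))

/-- `C_0^∞(a, b)` inside `PairSpaceLine`, through `w ↦ (w, |ξ|^μ 𝓕 w)`. The norm induced on it is
the norm `‖w‖_{H^μ(ℝ)} = (‖w‖² + ‖|ξ|^μ 𝓕 w‖²) ^ (1/2)`. -/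
def testGraph (μ a b : ℝ) : Submodule ℝ PairSpaceLine where
  carrier := {p | ∃ w : ℝ → ℝ, IsTestFunction a b w ∧ p.fst =ᵐ[volume] w ∧
    p.snd =ᵐ[volume] fun ξ => ((|ξ| ^ μ : ℝ) : ℂ) * 𝓕 (fun x => (w x : ℂ)) ξ}
  zero_mem' := by
    refine ⟨0, IsTestFunction.zero a b, Lp.coeFn_zero _ _ _, ?_⟩
    filter_upwards [Lp.coeFn_zero ℂ 2 (volume : Measure ℝ)] with ξ h
    rw [WithLp.zero_snd, h]
    simp [Real.fourier_eq]
  add_mem' := by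
    rintro p q ⟨w, hw, hp, hp'⟩ ⟨v, hv, hq, hq'⟩
    refine ⟨w + v, hw.add hv, (Lp.coeFn_add _ _).trans (hp.add hq), ?_⟩
    filter_upwards [Lp.coeFn_add p.snd q.snd, hp', hq'] with ξ h h1 h2
    have e : (fun x => ((w + v) x : ℂ)) = (fun x => (w x : ℂ)) + fun x => (v x : ℂ) := by
      ext x; simp
    have e' : 𝓕 ((fun x => (w x : ℂ)) + fun x => (v x : ℂ)) ξ
        = 𝓕 (fun x => (w x : ℂ)) ξ + 𝓕 (fun x => (v x : ℂ)) ξ := by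
      simp only [Real.fourier_eq, Pi.add_apply, smul_add]
      exact integral_add ((Real.fourierIntegral_convergent_iff ξ).2 hw.integrable_ofReal)
        ((Real.fourierIntegral_convergent_iff ξ).2 hv.integrable_ofReal)
    rw [WithLp.add_snd, h, Pi.add_apply, h1, h2, e, e', mul_add]
  smul_mem' := by
    rintro c p ⟨w, hw, hp, hp'⟩
    refine ⟨c • w, hw.const_smul c, (Lp.coeFn_smul _ _).trans (hp.const_smul c), ?_⟩
    filter_upwards [Lp.coeFn_smul c p.snd, hp'] with ξ h h1
    have e : (fun x => ((c • w) x : ℂ)) = c • fun x => (w x : ℂ) := by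
      ext x; simp
    have e' : 𝓕 (c • fun x => (w x : ℂ)) ξ = c • 𝓕 (fun x => (w x : ℂ)) ξ := by
      simp only [Real.fourier_eq, Pi.smul_apply]
      rw [← integral_smul]
      exact integral_congr_ae (Filter.Eventually.of_forall fun x => smul_comm _ _ _)
    rw [WithLp.smul_snd, h, Pi.smul_apply, h1, e, e', mul_smul_comm]

/-- The fractional Sobolev space `H^μ_0(a, b)`: the completion of `C_0^∞(a, b)` with respect to
`‖·‖_{H^μ(ℝ)}`, realised as a closure inside a Hilbert space. An element `φ` is the pair of the
function `φ.1.fst` (which determines it) and `|ξ|^μ` times the Fourier transform of it. -/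
def HZero (μ a b : ℝ) : Submodule ℝ PairSpaceLine :=
  (testGraph μ a b).topologicalClosure

/-- The function on `ℝ` (zero a.e. outside `(a, b)`) that an element of `H^μ_0(a, b)` is. -/
def HZero.fn {μ a b : ℝ} (φ : HZero μ a b) : ℝ → ℝ := φ.1.fst

/-- The space of pairs `(w, g)` in `L²(a, b) × L²(a, b)` with the norm
`(‖w‖² + ‖g‖²) ^ (1/2)`. -/
abbrev PairSpace (a b : ℝ) : Type :=
  WithLp 2 (Lp ℝ 2 (volume.restrict (Ioo a b)) × Lp ℝ 2 (volume.restrict (Ioo a b)))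

theorem integrable_Lp_mul {a b : ℝ} (w : Lp ℝ 2 (volume.restrict (Ioo a b)))
    {v : ℝ → ℝ} (hv : Continuous v) (hs : HasCompactSupport v) :
    Integrable (fun x => w x * v x) (volume.restrict (Ioo a b)) :=
  (Lp.memLp w).integrable_mul (q := 2) ((hv.memLp_of_hasCompactSupport hs).restrict _)

/-- The Sobolev space `H¹(a, b)`: the functions `w ∈ L²(a, b)` with a weak derivative
`g ∈ L²(a, b)`, as the pairs `(w, g)`, with the norm `(‖w‖² + ‖g‖²) ^ (1/2)`. -/
def HOne (a b : ℝ) : Submodule ℝ (PairSpace a b) where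
  carrier := {p | ∀ v : ℝ → ℝ, IsTestFunction a b v →
    ∫ x in Ioo a b, p.fst x * deriv v x = -∫ x in Ioo a b, p.snd x * v x}
  zero_mem' := by
    intro v _
    have h := Lp.coeFn_zero ℝ 2 (volume.restrict (Ioo a b))
    rw [integral_eq_zero_of_ae, integral_eq_zero_of_ae, neg_zero] <;>
    · filter_upwards [h] with x hx
      have hx' := hx
      simp only [Pi.zero_apply] at hx'
      simp only [WithLp.zero_fst, WithLp.zero_snd, hx', zero_mul, Pi.zero_apply]
  add_mem' := by
    intro p q hp hq v hv
    have hd : Continuous (deriv v) := hv.smooth.continuous_deriv (by simp)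
    have hds := hv.hasCompactSupport.deriv
    have hc := hv.smooth.continuous
    have hcs := hv.hasCompactSupport
    have e1 : ∫ x in Ioo a b, (p + q).fst x * deriv v x
        = (∫ x in Ioo a b, p.fst x * deriv v x) + ∫ x in Ioo a b, q.fst x * deriv v x := by
      rw [← integral_add (integrable_Lp_mul _ hd hds)
        (integrable_Lp_mul _ hd hds)]
      refine integral_congr_ae ?_
      filter_upwards [Lp.coeFn_add p.fst q.fst] with x hx
      rw [WithLp.add_fst, hx, Pi.add_apply, add_mul]
    have e2 : ∫ x in Ioo a b, (p + q).snd x * v x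
        = (∫ x in Ioo a b, p.snd x * v x) + ∫ x in Ioo a b, q.snd x * v x := by
      rw [← integral_add (integrable_Lp_mul _ hc hcs)
        (integrable_Lp_mul _ hc hcs)]
      refine integral_congr_ae ?_
      filter_upwards [Lp.coeFn_add p.snd q.snd] with x hx
      rw [WithLp.add_snd, hx, Pi.add_apply, add_mul]
    rw [e1, e2, hp v hv, hq v hv]
    ring
  smul_mem' := by
    intro c p hp v hv
    have e1 : ∫ x in Ioo a b, (c • p).fst x * deriv v x
        = c * ∫ x in Ioo a b, p.fst x * deriv v x := by
      rw [← integral_const_mul]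
      refine integral_congr_ae ?_
      filter_upwards [Lp.coeFn_smul c p.fst] with x hx
      rw [WithLp.smul_fst, hx, Pi.smul_apply, smul_eq_mul, mul_assoc]
    have e2 : ∫ x in Ioo a b, (c • p).snd x * v x = c * ∫ x in Ioo a b, p.snd x * v x := by
      rw [← integral_const_mul]
      refine integral_congr_ae ?_
      filter_upwards [Lp.coeFn_smul c p.snd] with x hx
      rw [WithLp.smul_snd, hx, Pi.smul_apply, smul_eq_mul, mul_assoc]
    rw [e1, e2, hp v hv]
    ring

/-- The function on `(a, b)` that an element of `H¹(a, b)` is. -/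
def HOne.fn {a b : ℝ} (w : HOne a b) : ℝ → ℝ := w.1.fst

/-- The range of the two-sided fractional integral operator on `H^{1-β}_0(0, 1)`: those
`w ∈ H¹(0, 1)` with `w = I φ` (a.e. on `(0, 1)`) for some `φ ∈ H^{1-β}_0(0, 1)`. -/
def fracIntRange (β θ : ℝ) : Set (HOne 0 1) :=
  {w | ∃ φ : HZero (1 - β) 0 1,
    HOne.fn w =ᵐ[volume.restrict (Ioo (0 : ℝ) 1)] twoSidedFracInt 0 1 θ β (HZero.fn φ)}

end

/-!
On the Fourier side `D I_±^β φ` is `2πiξ (±2πiξ)^{-β} 𝓕φ`. Hence the derivatives `u`, `v` of the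
left and the right potential of `φ` both have `L²(ℝ)` norm `N = (2π)^{1-β} ‖|ξ|^{1-β} 𝓕φ‖`, and
their phases differ by `πβ`, so that `re ⟪u, v⟫ = cos(πβ) N²`. Since `u` vanishes to the left of the
interval and `v` to its right, this inner product is carried by the interval. There,
`⟪θ u + (1 - θ) v, u + v⟫ ≥ ⟪u, v⟫` and Cauchy-Schwarz give `2 ‖D I_θ^β φ‖ ≥ cos(πβ) N`. As `1 - β`
exceeds `1/2`, the seminorm `‖|ξ|^{1-β} 𝓕φ‖` bounds `φ` uniformly, hence in `L²`, so the operator is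
bounded below.
-/

noncomputable section

open Filter Topology ProbabilityTheory Complex
open scoped Real ENNReal NNReal

/-- The Riemann-Liouville measure `t ^ (β - 1) / Γ(β) dt` on the half-line: fractional integration
of order `β` is the convolution with it. -/
def fracMeasure (β : ℝ) : Measure ℝ :=
  (volume.restrict (Ioi 0)).withDensity fun t => ENNReal.ofReal ((Real.Gamma β)⁻¹ * t ^ (β - 1))

section FracMeasure

variable {E : Type*} [NormedAddCommGroup E] [NormedSpace ℝ E] {β : ℝ}

instance fracMeasure.instSigmaFinite : SigmaFinite (fracMeasure β) :=
  SigmaFinite.withDensity_ofReal _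

theorem fracMeasure_absolutelyContinuous : fracMeasure β ≪ volume :=
  (withDensity_absolutelyContinuous _ _).trans Measure.restrict_le_self.absolutelyContinuous

theorem ae_fracMeasure_pos : ∀ᵐ t ∂fracMeasure β, 0 < t :=
  (withDensity_absolutelyContinuous _ _).ae_le (ae_restrict_mem measurableSet_Ioi)

theorem measurable_fracDensity :
    Measurable fun t : ℝ => ENNReal.ofReal ((Real.Gamma β)⁻¹ * t ^ (β - 1)) := by
  fun_prop

theorem toReal_fracDensity (hβ : 0 < β) {t : ℝ} (ht : 0 < t) :
    (ENNReal.ofReal ((Real.Gamma β)⁻¹ * t ^ (β - 1))).toReal = (Real.Gamma β)⁻¹ * t ^ (β - 1) :=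
  ENNReal.toReal_ofReal (mul_nonneg (inv_nonneg.2 (Real.Gamma_pos_of_pos hβ).le)
    (Real.rpow_nonneg ht.le _))

theorem integral_fracMeasure (hβ : 0 < β) (f : ℝ → E) :
    ∫ t, f t ∂fracMeasure β = (Real.Gamma β)⁻¹ • ∫ t in Ioi 0, t ^ (β - 1) • f t := by
  rw [fracMeasure, integral_withDensity_eq_integral_toReal_smul measurable_fracDensity
    (Eventually.of_forall fun _ => ENNReal.ofReal_lt_top),
    ← integral_smul]
  refine setIntegral_congr_fun measurableSet_Ioi fun t ht => ?_
  rw [toReal_fracDensity hβ ht, mul_smul]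

theorem integrable_fracMeasure_iff (hβ : 0 < β) {f : ℝ → E} :
    Integrable f (fracMeasure β) ↔ IntegrableOn (fun t => t ^ (β - 1) • f t) (Ioi 0) := by
  rw [fracMeasure, integrable_withDensity_iff_integrable_smul' measurable_fracDensity
    (Eventually.of_forall fun _ => ENNReal.ofReal_lt_top), IntegrableOn,
    ← integrable_fun_smul_iff (inv_ne_zero (Real.Gamma_pos_of_pos hβ).ne')
      fun t => t ^ (β - 1) • f t]
  refine integrable_congr ((ae_restrict_iff' measurableSet_Ioi).2 (Eventually.of_forall ?_))
  intro t ht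
  simp only [toReal_fracDensity hβ ht, mul_smul]

theorem integrable_exp_neg_mul_fracMeasure (hβ : 0 < β) {r : ℝ} (hr : 0 < r) :
    Integrable (fun t => Real.exp (-(r * t))) (fracMeasure β) := by
  rw [integrable_fracMeasure_iff hβ]
  simpa only [smul_eq_mul, Real.rpow_one, neg_mul] using
    integrableOn_rpow_mul_exp_neg_mul_rpow (p := 1) (by linarith : -1 < β - 1) one_pos hr

theorem mgf_id_fracMeasure (hβ : 0 < β) {r : ℝ} (hr : 0 < r) :
    mgf id (fracMeasure β) (-r) = r ^ (-β) := by
  simp only [mgf, id, neg_mul]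
  rw [integral_fracMeasure hβ]
  simp only [smul_eq_mul]
  rw [Real.integral_rpow_mul_exp_neg_mul_Ioi hβ hr, mul_comm, mul_assoc,
    mul_inv_cancel₀ (Real.Gamma_pos_of_pos hβ).ne', mul_one, one_div, Real.inv_rpow hr.le,
    ← Real.rpow_neg hr.le]

/-- Both sides are analytic in the half-plane `0 < re r` and agree for real `r`. -/
theorem complexMGF_id_fracMeasure (hβ : 0 < β) {r : ℂ} (hr : 0 < r.re) :
    complexMGF id (fracMeasure β) (-r) = r ^ (-(β : ℂ)) := by
  have hexp : Iio 0 ⊆ interior (integrableExpSet id (fracMeasure β)) :=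
    interior_maximal (fun s (hs : s < 0) => by
      simpa using! integrable_exp_neg_mul_fracMeasure hβ (neg_pos.2 hs)) isOpen_Iio
  have hL : AnalyticOnNhd ℂ (fun z => complexMGF id (fracMeasure β) (-z)) {z | 0 < z.re} :=
    analyticOnNhd_complexMGF.comp analyticOnNhd_id.neg fun z hz => hexp (by simpa using hz)
  have hR : AnalyticOnNhd ℂ (fun z : ℂ => z ^ (-(β : ℂ))) {z | 0 < z.re} :=
    analyticOnNhd_id.cpow analyticOnNhd_const fun z hz => Or.inl hz
  have hreal : ∀ᶠ x : ℝ in 𝓝[≠] 1,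
      complexMGF id (fracMeasure β) (-(x : ℂ)) = (x : ℂ) ^ (-(β : ℂ)) := by
    filter_upwards [mem_nhdsWithin_of_mem_nhds (Ioi_mem_nhds one_pos)] with x hx
    rw [← ofReal_neg, complexMGF_ofReal, mgf_id_fracMeasure hβ hx, ofReal_cpow hx.le, ofReal_neg]
  have hcoe : Tendsto ((↑) : ℝ → ℂ) (𝓝[≠] 1) (𝓝[≠] 1) :=
    tendsto_nhdsWithin_iff.2 ⟨(continuous_ofReal.tendsto' 1 1 ofReal_one).mono_left
      nhdsWithin_le_nhds, eventually_nhdsWithin_of_forall fun x hx => by simpa using hx⟩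
  exact hL.eqOn_of_preconnected_of_frequently_eq hR (convex_halfSpace_re_gt 0).isPreconnected
    (z₀ := 1) (by simp) (hcoe.frequently hreal.frequently) hr

end FracMeasure

/-- The Fourier symbol `(2πi e ξ) ^ (-β)` of fractional integration of order `β` from the left
(`e = 1`) or from the right (`e = -1`). -/
def fracSymbol (β e ξ : ℝ) : ℂ :=
  (2 * π * I * (e * ξ : ℝ)) ^ (-(β : ℂ))

section FourierTransform

variable {β e : ℝ} {G : ℝ → ℂ}

theorem integral_cexp_mul_fourier_fracMeasure (hβ : 0 < β) {ε : ℝ} (hε : 0 < ε)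
    (hG : Integrable G) :
    ∫ t, cexp (-(ε * t)) * 𝓕 G (e * t) ∂fracMeasure β
      = ∫ ξ : ℝ, (ε + 2 * π * I * (e * ξ : ℝ)) ^ (-(β : ℂ)) * G ξ := by
  have hexp : Integrable (fun t : ℝ => cexp (-(ε * t))) (fracMeasure β) := by
    simpa using (integrable_exp_neg_mul_fracMeasure hβ hε).ofReal (𝕜 := ℂ)
  have hflip := VectorFourier.integral_fourierIntegral_smul_eq_flip (L := e • innerₗ ℝ)
    Real.continuous_fourierChar (by simpa using! continuous_inner.const_smul e) hexp hG
  calc ∫ t, cexp (-(ε * t)) * 𝓕 G (e * t) ∂fracMeasure β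
      = ∫ t, cexp (-(ε * t)) • VectorFourier.fourierIntegral Real.fourierChar volume
          (e • innerₗ ℝ).flip G t ∂fracMeasure β := by
        congr 1 with t
        simp [VectorFourier.fourierIntegral, Real.fourier_eq, mul_assoc, mul_comm t]
    _ = _ := hflip.symm
    _ = _ := by
        congr 1 with ξ
        rw [smul_eq_mul, ← complexMGF_id_fracMeasure hβ (by simpa using hε), complexMGF,
          VectorFourier.fourierIntegral]
        congr 2 with t
        rw [Circle.smul_def, Real.fourierChar_apply, smul_eq_mul, ← Complex.exp_add]
        simp
        ring_nf

theorem norm_cpow_neg_le (hβ : 0 ≤ β) (he : |e| = 1) (ε : ℝ) {ξ : ℝ} (hξ : ξ ≠ 0) :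
    ‖(ε + 2 * π * I * (e * ξ : ℝ) : ℂ) ^ (-(β : ℂ))‖ ≤ |ξ| ^ (-β) := by
  have hle : |ξ| ≤ ‖(ε + 2 * π * I * (e * ξ : ℝ) : ℂ)‖ :=
    calc |ξ| ≤ 2 * π * |ξ| := le_mul_of_one_le_left (abs_nonneg ξ) (by linarith [Real.pi_gt_three])
      _ = |(ε + 2 * π * I * (e * ξ : ℝ) : ℂ).im| := by simp [abs_mul, he, abs_of_pos Real.pi_pos]
      _ ≤ _ := abs_im_le_norm _
  rw [← ofReal_neg, norm_cpow_real]
  exact Real.rpow_le_rpow_of_nonpos (abs_pos.2 hξ) hle (neg_nonpos.2 hβ)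

theorem tendsto_integral_cexp_mul_fourier_fracMeasure
    (hFG : Integrable (fun t => 𝓕 G (e * t)) (fracMeasure β)) :
    Tendsto (fun ε : ℝ => ∫ t, cexp (-(ε * t)) * 𝓕 G (e * t) ∂fracMeasure β) (𝓝[>] 0)
      (𝓝 (∫ t, 𝓕 G (e * t) ∂fracMeasure β)) := by
  refine tendsto_integral_filter_of_dominated_convergence _
    (Eventually.of_forall fun ε => ?_) ?_ hFG.norm (Eventually.of_forall fun t => ?_)
  · exact AEStronglyMeasurable.mul (by fun_prop) hFG.aestronglyMeasurable
  · filter_upwards [self_mem_nhdsWithin] with ε (hε : 0 < ε)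
    filter_upwards [ae_fracMeasure_pos] with t ht
    rw [norm_mul, norm_exp]
    refine mul_le_of_le_one_left (norm_nonneg _) (Real.exp_le_one_iff.2 ?_)
    simpa using (mul_pos hε ht).le
  · have hc : Continuous fun ε : ℝ => cexp (-(ε * t)) * 𝓕 G (e * t) := by fun_prop
    simpa using (hc.tendsto 0).mono_left nhdsWithin_le_nhds

theorem tendsto_integral_cpow_mul (hβ : 0 ≤ β) (he : |e| = 1) (hG : Integrable G)
    (hG' : Integrable fun ξ => |ξ| ^ (-β) * ‖G ξ‖) :
    Tendsto (fun ε : ℝ => ∫ ξ : ℝ, (ε + 2 * π * I * (e * ξ : ℝ) : ℂ) ^ (-(β : ℂ)) * G ξ)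
      (𝓝[>] 0) (𝓝 (∫ ξ, fracSymbol β e ξ * G ξ)) := by
  have he0 : e ≠ 0 := by rintro rfl; simp at he
  refine tendsto_integral_filter_of_dominated_convergence _
    (Eventually.of_forall fun ε => ?_) (Eventually.of_forall fun ε => ?_) hG' ?_
  · exact (Measurable.pow_const (by fun_prop) _).aestronglyMeasurable.mul hG.aestronglyMeasurable
  · filter_upwards [volume.ae_ne 0] with ξ hξ
    rw [norm_mul]
    exact mul_le_mul_of_nonneg_right (norm_cpow_neg_le hβ he ε hξ) (norm_nonneg _)
  · filter_upwards [volume.ae_ne 0] with ξ hξ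
    have hslit : ((0 : ℝ) : ℂ) + 2 * π * I * (e * ξ : ℝ) ∈ slitPlane := by
      right; simp [hξ, he0, Real.pi_ne_zero]
    have hc : ContinuousAt (fun ε : ℝ => (ε + 2 * π * I * (e * ξ : ℝ) : ℂ) ^ (-(β : ℂ))) 0 :=
      ContinuousAt.cpow (by fun_prop) continuousAt_const hslit
    simpa [fracSymbol] using (hc.tendsto.mono_left nhdsWithin_le_nhds).mul_const (G ξ)

theorem integral_fourier_fracMeasure (hβ : 0 < β) (he : |e| = 1) (hG : Integrable G)
    (hG' : Integrable fun ξ => |ξ| ^ (-β) * ‖G ξ‖)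
    (hFG : Integrable (fun t => 𝓕 G (e * t)) (fracMeasure β)) :
    ∫ t, 𝓕 G (e * t) ∂fracMeasure β = ∫ ξ, fracSymbol β e ξ * G ξ := by
  refine tendsto_nhds_unique (tendsto_integral_cexp_mul_fourier_fracMeasure hFG)
    (Tendsto.congr' ?_ (tendsto_integral_cpow_mul hβ.le he hG hG'))
  filter_upwards [self_mem_nhdsWithin] with ε hε
  exact (integral_cexp_mul_fourier_fracMeasure hβ hε hG).symm

end FourierTransform

/-- The Fourier symbol of the derivative of fractional integration of order `β`, divided by
`|ξ| ^ (1 - β)` because it is applied to `|ξ| ^ (1 - β) 𝓕 w`. -/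
def fracDerivSymbol (β e ξ : ℝ) : ℂ :=
  2 * π * I * ξ * fracSymbol β e ξ / (|ξ| ^ (1 - β) : ℝ)

section Symbol

variable {β e ξ : ℝ}

theorem measurable_fracSymbol : Measurable (fracSymbol β e) := by
  unfold fracSymbol
  exact Measurable.pow_const (by fun_prop) _

theorem measurable_fracDerivSymbol : Measurable (fracDerivSymbol β e) := by
  have := measurable_fracSymbol (β := β) (e := e)
  unfold fracDerivSymbol
  fun_prop

theorem norm_fracSymbol : ‖fracSymbol β e ξ‖ = (2 * π) ^ (-β) * |e| ^ (-β) * |ξ| ^ (-β) := by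
  rw [fracSymbol, ← ofReal_neg, norm_cpow_real, ← Real.mul_rpow Real.two_pi_pos.le (abs_nonneg _),
    ← Real.mul_rpow (by positivity) (abs_nonneg _)]
  simp [abs_of_pos Real.pi_pos, mul_assoc]

theorem norm_fracDerivSymbol (hξ : ξ ≠ 0) :
    ‖fracDerivSymbol β e ξ‖ = (2 * π) ^ (1 - β) * |e| ^ (-β) := by
  have hpos : 0 < |ξ| := abs_pos.2 hξ
  have hnorm : ‖(2 * π * I * ξ : ℂ)‖ = 2 * π * |ξ| := by simp [abs_of_pos Real.pi_pos]
  rw [fracDerivSymbol, norm_div, norm_mul, norm_fracSymbol, hnorm, norm_real,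
    Real.norm_of_nonneg (by positivity), div_eq_iff (by positivity), sub_eq_neg_add,
    Real.rpow_add_one Real.two_pi_pos.ne', Real.rpow_add_one hpos.ne']
  ring

theorem norm_fracDerivSymbol_le : ‖fracDerivSymbol β e ξ‖ ≤ (2 * π) ^ (1 - β) * |e| ^ (-β) := by
  rcases eq_or_ne ξ 0 with rfl | hξ
  · rw [fracDerivSymbol, ofReal_zero, mul_zero, zero_mul, zero_div, norm_zero]
    positivity
  · exact (norm_fracDerivSymbol hξ).le

theorem memLp_top_fracDerivSymbol : MemLp (fracDerivSymbol β e) ∞ volume :=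
  memLp_top_of_bound measurable_fracDerivSymbol.aestronglyMeasurable _
    (Eventually.of_forall fun _ => norm_fracDerivSymbol_le)

theorem fracDerivSymbol_mul (hξ : ξ ≠ 0) :
    fracDerivSymbol β e ξ * (|ξ| ^ (1 - β) : ℝ) = 2 * π * I * ξ * fracSymbol β e ξ :=
  div_mul_cancel₀ _ (by exact_mod_cast (Real.rpow_pos_of_pos (abs_pos.2 hξ) _).ne')

theorem arg_two_pi_mul_I_mul (hξ : ξ ≠ 0) : |arg (2 * π * I * ξ)| = π / 2 := by
  have hz : (2 * π * I * ξ : ℂ) = (2 * π * ξ : ℝ) * I := by push_cast; ring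
  rcases lt_or_gt_of_ne hξ with h | h
  · rw [hz, show ((2 * π * ξ : ℝ) : ℂ) * I = (2 * π * -ξ : ℝ) * -I by push_cast; ring,
      arg_real_mul _ (by have := neg_pos.2 h; positivity), arg_neg_I, abs_neg,
      abs_of_pos Real.pi_div_two_pos]
  · rw [hz, arg_real_mul _ (by positivity), arg_I, abs_of_pos Real.pi_div_two_pos]

theorem conj_fracSymbol (hξ : e * ξ ≠ 0) :
    (starRingEnd ℂ) (fracSymbol β e ξ) = fracSymbol β (-e) ξ := by
  have harg : arg (2 * π * I * (e * ξ : ℝ)) ≠ π := fun h => by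
    have := arg_two_pi_mul_I_mul hξ
    rw [h, abs_of_pos Real.pi_pos] at this
    linarith [Real.pi_pos]
  simpa [fracSymbol, map_ofNat] using (conj_cpow _ (-(β : ℂ)) harg).symm

theorem re_fracSymbol_sq (hξ : e * ξ ≠ 0) :
    (fracSymbol β e ξ ^ 2).re = Real.cos (π * β) * ‖fracSymbol β e ξ‖ ^ 2 := by
  have hsq : fracSymbol β e ξ ^ 2 = (2 * π * I * (e * ξ : ℝ)) ^ ((-β * 2 : ℝ) : ℂ) := by
    rw [fracSymbol, ← cpow_mul_nat]
    push_cast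
    ring_nf
  rw [hsq, cpow_ofReal_re, Real.rpow_mul (norm_nonneg _), fracSymbol, ← ofReal_neg, norm_cpow_real,
    Real.rpow_two, mul_comm, ← Real.cos_abs, abs_mul, arg_two_pi_mul_I_mul hξ,
    ← Real.cos_abs (π * β),
    abs_mul π, abs_mul, abs_neg, abs_of_pos Real.pi_pos, abs_two]
  ring_nf

theorem re_conj_fracDerivSymbol_mul (hξ : e * ξ ≠ 0) :
    ((starRingEnd ℂ) (fracDerivSymbol β e ξ) * fracDerivSymbol β (-e) ξ).re
      = Real.cos (π * β) * ((2 * π) ^ (1 - β) * |e| ^ (-β)) ^ 2 := by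
  have hmul : (starRingEnd ℂ) (fracDerivSymbol β e ξ) * fracDerivSymbol β (-e) ξ
      = ((2 * π * ξ / |ξ| ^ (1 - β)) ^ 2 : ℝ) * fracSymbol β (-e) ξ ^ 2 := by
    simp only [fracDerivSymbol, map_div₀, map_mul, conj_fracSymbol hξ, conj_ofReal, conj_I,
      map_ofNat]
    push_cast
    linear_combination (-(2 * π * ξ / (|ξ| ^ (1 - β) : ℝ)) ^ 2 * fracSymbol β (-e) ξ ^ 2 : ℂ) * I_sq
  have hnorm : ‖fracDerivSymbol β e ξ‖ ^ 2
      = (2 * π * ξ / |ξ| ^ (1 - β)) ^ 2 * ‖fracSymbol β (-e) ξ‖ ^ 2 := by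
    rw [fracDerivSymbol, norm_div, norm_mul, ← conj_fracSymbol hξ, RCLike.norm_conj, norm_real]
    simp [mul_pow, div_pow]
    ring
  rw [hmul, re_ofReal_mul, re_fracSymbol_sq (by simpa using hξ),
    ← norm_fracDerivSymbol (right_ne_zero_of_mul hξ), hnorm]
  ring

end Symbol

/-- The derivative of fractional integration of order `β` as a Fourier multiplier on `L²(ℝ)`: it
sends `|ξ| ^ (1 - β) 𝓕 w` to the derivative of the fractional integral of `w`. -/
def fracDeriv (β e : ℝ) : Lp ℂ 2 (volume : Measure ℝ) →L[ℂ] Lp ℂ 2 (volume : Measure ℝ) :=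
  ((Lp.fourierTransformₗᵢ ℝ ℂ).symm : Lp ℂ 2 (volume : Measure ℝ) →L[ℂ] _) ∘L
    (ContinuousLinearMap.mul ℂ ℂ).holderL volume ∞ 2 2
      (memLp_top_fracDerivSymbol (β := β) (e := e)).toLp

section FracDeriv

variable {β e : ℝ} (g : Lp ℂ 2 (volume : Measure ℝ))

theorem fourier_fracDeriv :
    (𝓕 (fracDeriv β e g) : Lp ℂ 2 (volume : Measure ℝ)) =ᵐ[volume]
      fun ξ => fracDerivSymbol β e ξ * g ξ := by
  have hF : 𝓕 (fracDeriv β e g)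
      = (ContinuousLinearMap.mul ℂ ℂ).holder 2 memLp_top_fracDerivSymbol.toLp g :=
    (Lp.fourierTransformₗᵢ ℝ ℂ).apply_symm_apply _
  rw [hF]
  filter_upwards [(ContinuousLinearMap.mul ℂ ℂ).coeFn_holder (r := 2)
    memLp_top_fracDerivSymbol.toLp g, memLp_top_fracDerivSymbol.coeFn_toLp] with ξ h1 h2
  rw [h1, h2, ContinuousLinearMap.mul_apply']

theorem norm_fracDeriv_le : ‖fracDeriv β e g‖ ≤ (2 * π) ^ (1 - β) * |e| ^ (-β) * ‖g‖ := by
  rw [← Lp.norm_fourier_eq]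
  refine Lp.norm_le_mul_norm_of_ae_le_mul ?_
  filter_upwards [fourier_fracDeriv g] with ξ hξ
  rw [hξ, norm_mul]
  exact mul_le_mul_of_nonneg_right norm_fracDerivSymbol_le (norm_nonneg _)

theorem re_inner_fracDeriv (he : e ≠ 0) :
    (inner ℂ (fracDeriv β e g) (fracDeriv β (-e) g)).re
      = Real.cos (π * β) * ((2 * π) ^ (1 - β) * |e| ^ (-β) * ‖g‖) ^ 2 := by
  have hg : ‖g‖ ^ 2 = ∫ ξ, ‖g ξ‖ ^ 2 := by
    rw [norm_sq_eq_re_inner (𝕜 := ℂ), L2.inner_def, ← integral_re (L2.integrable_inner _ _)]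
    simp only [← norm_sq_eq_re_inner]
  rw [← Lp.inner_fourier_eq, L2.inner_def, ← RCLike.re_eq_complex_re,
    ← integral_re (L2.integrable_inner _ _), mul_pow, ← mul_assoc, hg, ← integral_const_mul]
  refine integral_congr_ae ?_
  filter_upwards [fourier_fracDeriv (e := e) g, fourier_fracDeriv (e := -e) g, volume.ae_ne 0]
    with ξ h1 h2 hξ
  have hinner : inner ℂ (fracDerivSymbol β e ξ * g ξ) (fracDerivSymbol β (-e) ξ * g ξ)
      = (‖g ξ‖ ^ 2 : ℝ) * ((starRingEnd ℂ) (fracDerivSymbol β e ξ) * fracDerivSymbol β (-e) ξ) := by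
    rw [RCLike.inner_apply, map_mul, ← normSq_eq_norm_sq, ← mul_conj]
    ring
  rw [h1, h2, hinner, RCLike.re_eq_complex_re, re_ofReal_mul,
    re_conj_fracDerivSymbol_mul (mul_ne_zero he hξ), mul_comm]

end FracDeriv

section FracMeasureBound

variable {E : Type*} [NormedAddCommGroup E] {β C : ℝ} {f : ℝ → E}

theorem fracMeasure_restrict_Ioi_one_le (hβ : 0 < β) (hβ1 : β ≤ 1) :
    (fracMeasure β).restrict (Ioi 1) ≤ ENNReal.ofReal (Real.Gamma β)⁻¹ • volume := by
  rw [fracMeasure, restrict_withDensity measurableSet_Ioi, Measure.restrict_restrict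
    measurableSet_Ioi]
  calc _ ≤ ((volume : Measure ℝ).restrict (Ioi 1 ∩ Ioi 0)).withDensity
        fun _ => ENNReal.ofReal (Real.Gamma β)⁻¹ := by
        refine withDensity_mono ?_
        filter_upwards [ae_restrict_mem (measurableSet_Ioi.inter measurableSet_Ioi)] with t ht
        exact ENNReal.ofReal_le_ofReal (mul_le_of_le_one_right
          (inv_nonneg.2 (Real.Gamma_pos_of_pos hβ).le)
          (Real.rpow_le_one_of_one_le_of_nonpos ht.1.le (by linarith)))
    _ ≤ _ := by
        rw [withDensity_const]
        gcongr
        exact Measure.restrict_le_self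

theorem fracMeasure_Iic_lt_top (hβ : 0 < β) (r : ℝ) : fracMeasure β (Iic r) < ⊤ := by
  have h := (integrable_exp_neg_mul_fracMeasure hβ one_pos).measure_norm_ge_lt_top
    (Real.exp_pos (-r))
  refine (measure_mono fun t (ht : t ≤ r) => ?_).trans_lt h
  simpa using ht

theorem integrable_fracMeasure (hβ : 0 < β) (hβ1 : β ≤ 1) (hf : Integrable f)
    (hC : ∀ᵐ t, ‖f t‖ ≤ C) : Integrable f (fracMeasure β) := by
  rw [← integrableOn_univ, ← Iic_union_Ioi (a := (1 : ℝ))]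
  refine IntegrableOn.union ?_ ?_
  · exact Measure.integrableOn_of_bounded (fracMeasure_Iic_lt_top hβ 1).ne
      (hf.aestronglyMeasurable.mono_ac fracMeasure_absolutelyContinuous)
      (ae_restrict_of_ae (fracMeasure_absolutelyContinuous.ae_le hC))
  · exact (hf.smul_measure ENNReal.ofReal_ne_top).mono_measure
      (fracMeasure_restrict_Ioi_one_le hβ hβ1)

theorem integral_norm_fracMeasure_le (hβ : 0 < β) (hβ1 : β ≤ 1) (hf : Integrable f)
    (hC : ∀ᵐ t, ‖f t‖ ≤ C) :
    ∫ t, ‖f t‖ ∂fracMeasure β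
      ≤ (fracMeasure β).real (Iic 1) * C + (Real.Gamma β)⁻¹ * ∫ t, ‖f t‖ := by
  have hint := (integrable_fracMeasure hβ hβ1 hf hC).norm
  have hnear : ∫ t in Iic 1, ‖f t‖ ∂fracMeasure β ≤ (fracMeasure β).real (Iic 1) * C := by
    rw [← smul_eq_mul, ← setIntegral_const]
    refine setIntegral_mono_ae hint.integrableOn
      (integrableOn_const (fracMeasure_Iic_lt_top hβ 1).ne) ?_
    exact fracMeasure_absolutelyContinuous.ae_le hC
  have hfar : ∫ t in Ioi 1, ‖f t‖ ∂fracMeasure β ≤ (Real.Gamma β)⁻¹ * ∫ t, ‖f t‖ := by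
    refine (integral_mono_measure (fracMeasure_restrict_Ioi_one_le hβ hβ1)
      (Eventually.of_forall fun t => norm_nonneg _)
      (hf.norm.smul_measure ENNReal.ofReal_ne_top)).trans_eq ?_
    rw [integral_smul_measure, ENNReal.toReal_ofReal
      (inv_nonneg.2 (Real.Gamma_pos_of_pos hβ).le), smul_eq_mul]
  rw [← setIntegral_univ, ← Iic_union_Ioi (a := (1 : ℝ)), setIntegral_union
    (Iic_disjoint_Ioi le_rfl) measurableSet_Ioi hint.integrableOn hint.integrableOn]
  exact add_le_add hnear hfar

end FracMeasureBound

/-- The fractional integral of order `β` over a half-line: from `-∞` if `e = 1`, and up to `∞`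
if `e = -1`. -/
def fracInt {E : Type*} [NormedAddCommGroup E] [NormedSpace ℝ E] (β e : ℝ) (φ : ℝ → E) (x : ℝ) :
    E :=
  ∫ t, φ (x - e * t) ∂fracMeasure β

section FracInt

variable {E : Type*} [NormedAddCommGroup E] {β e C : ℝ} {φ ψ : ℝ → E}

theorem quasiMeasurePreserving_sub_mul (he : e ≠ 0) (x : ℝ) :
    Measure.QuasiMeasurePreserving (fun t => x - e * t) := by
  simpa [sub_eq_add_neg, Function.comp_def] using!
    (Measure.measurePreserving_sub_left volume x).quasiMeasurePreserving.comp
      (Measure.quasiMeasurePreserving_smul volume he)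

theorem integrable_comp_sub_mul (he : e ≠ 0) (hφ : Integrable φ) (x : ℝ) :
    Integrable fun t => φ (x - e * t) :=
  (hφ.comp_sub_left x).comp_mul_left' he

theorem integrable_fracInt (hβ : 0 < β) (hβ1 : β ≤ 1) (he : e ≠ 0) (hφ : Integrable φ)
    (hC : ∀ᵐ x, ‖φ x‖ ≤ C) (x : ℝ) : Integrable (fun t => φ (x - e * t)) (fracMeasure β) :=
  integrable_fracMeasure hβ hβ1 (integrable_comp_sub_mul he hφ x)
    ((quasiMeasurePreserving_sub_mul he x).ae hC)

theorem integral_norm_comp_fracMeasure_le (hβ : 0 < β) (hβ1 : β ≤ 1) (he : e ≠ 0)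
    (hφ : Integrable φ) (hC : ∀ᵐ x, ‖φ x‖ ≤ C) (x : ℝ) :
    ∫ t, ‖φ (x - e * t)‖ ∂fracMeasure β
      ≤ (fracMeasure β).real (Iic 1) * C + (Real.Gamma β)⁻¹ * (|e|⁻¹ * ∫ t, ‖φ t‖) := by
  refine (integral_norm_fracMeasure_le hβ hβ1 (integrable_comp_sub_mul he hφ x)
    ((quasiMeasurePreserving_sub_mul he x).ae hC)).trans_eq ?_
  rw [Measure.integral_comp_mul_left (fun t => ‖φ (x - t)‖) e, abs_inv, smul_eq_mul,
    integral_sub_left_eq_self (fun t => ‖φ t‖) volume x]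

theorem aestronglyMeasurable_comp_sub_mul (hφ : AEStronglyMeasurable φ) :
    AEStronglyMeasurable (fun p : ℝ × ℝ => φ (p.1 - e * p.2)) (volume.prod (fracMeasure β)) := by
  refine hφ.comp_quasiMeasurePreserving (QuasiMeasurePreserving.prod_of_left
    (by fun_prop) (Eventually.of_forall fun t => ?_))
  exact (measurePreserving_sub_right volume (e * t)).quasiMeasurePreserving

variable [NormedSpace ℝ E]

theorem fracInt_congr_ae (he : e ≠ 0) (h : φ =ᵐ[volume] ψ) : fracInt β e φ = fracInt β e ψ := by
  ext x
  exact integral_congr_ae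
    (fracMeasure_absolutelyContinuous.ae_le ((quasiMeasurePreserving_sub_mul he x).ae h))

theorem norm_fracInt_le (hβ : 0 < β) (hβ1 : β ≤ 1) (he : e ≠ 0)
    (hφ : Integrable φ) (hC : ∀ᵐ x, ‖φ x‖ ≤ C) (x : ℝ) :
    ‖fracInt β e φ x‖
      ≤ (fracMeasure β).real (Iic 1) * C + (Real.Gamma β)⁻¹ * (|e|⁻¹ * ∫ t, ‖φ t‖) :=
  (norm_integral_le_integral_norm _).trans (integral_norm_comp_fracMeasure_le hβ hβ1 he hφ hC x)

theorem aestronglyMeasurable_fracInt (hφ : AEStronglyMeasurable φ) :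
    AEStronglyMeasurable (fracInt β e φ) :=
  (aestronglyMeasurable_comp_sub_mul hφ).integral_prod_right'

theorem fracInt_ofReal {w : ℝ → ℝ} (x : ℝ) :
    fracInt β e (fun s => (w s : ℂ)) x = fracInt β e w x :=
  integral_ofReal

end FracInt

section Fubini

variable {𝕜 : Type*} [RCLike 𝕜] {β e C : ℝ} {u φ : ℝ → 𝕜}

theorem integrable_prod_inner_fracMeasure (hβ : 0 < β) (hβ1 : β ≤ 1) (he : e ≠ 0)
    (hu : Integrable u) (hφ : Integrable φ) (hC : ∀ᵐ x, ‖φ x‖ ≤ C) :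
    Integrable (fun p : ℝ × ℝ => inner 𝕜 (u p.1) (φ (p.1 - e * p.2)))
      (volume.prod (fracMeasure β)) := by
  have hmeas := (hu.aestronglyMeasurable.comp_fst (ν := fracMeasure β)).inner (𝕜 := 𝕜)
    (aestronglyMeasurable_comp_sub_mul (β := β) (e := e) hφ.aestronglyMeasurable)
  have hint (s : ℝ) : Integrable (fun t => inner 𝕜 (u s) (φ (s - e * t))) (fracMeasure β) :=
    (integrable_fracInt hβ hβ1 he hφ hC s).const_inner (u s)
  set K := (fracMeasure β).real (Iic 1) * C + (Real.Gamma β)⁻¹ * (|e|⁻¹ * ∫ t, ‖φ t‖)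
  have hle (s : ℝ) : ∫ t, ‖inner 𝕜 (u s) (φ (s - e * t))‖ ∂fracMeasure β ≤ ‖u s‖ * K :=
    calc ∫ t, ‖inner 𝕜 (u s) (φ (s - e * t))‖ ∂fracMeasure β
        ≤ ∫ t, ‖u s‖ * ‖φ (s - e * t)‖ ∂fracMeasure β :=
          integral_mono (hint s).norm ((integrable_fracInt hβ hβ1 he hφ hC s).norm.const_mul ‖u s‖)
            fun t => norm_inner_le_norm (u s) (φ (s - e * t))
      _ = ‖u s‖ * ∫ t, ‖φ (s - e * t)‖ ∂fracMeasure β := integral_const_mul _ _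
      _ ≤ ‖u s‖ * K := mul_le_mul_of_nonneg_left
          (integral_norm_comp_fracMeasure_le hβ hβ1 he hφ hC s) (norm_nonneg (u s))
  refine (integrable_prod_iff hmeas).2 ⟨Eventually.of_forall hint,
    (hu.norm.mul_const K).mono' hmeas.norm.integral_prod_right' (Eventually.of_forall fun s => ?_)⟩
  rw [Real.norm_of_nonneg (integral_nonneg fun t => norm_nonneg _)]
  exact hle s

theorem integral_inner_fracInt (hβ : 0 < β) (hβ1 : β ≤ 1) (he : e ≠ 0)
    (hu : Integrable u) (hφ : Integrable φ) (hC : ∀ᵐ x, ‖φ x‖ ≤ C) :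
    ∫ s, inner 𝕜 (u s) (fracInt β e φ s)
      = ∫ t, (∫ s, inner 𝕜 (u s) (φ (s - e * t))) ∂fracMeasure β := by
  rw [← integral_integral_swap (integrable_prod_inner_fracMeasure hβ hβ1 he hu hφ hC)]
  congr 1 with s
  exact (integral_inner (integrable_fracInt hβ hβ1 he hφ hC s) (u s)).symm

theorem integral_fracInt_inner {C' : ℝ} (hβ : 0 < β) (hβ1 : β ≤ 1) (he : e ≠ 0)
    (hu : Integrable u) (hC' : ∀ᵐ x, ‖u x‖ ≤ C') (hφ : Integrable φ) (hC : ∀ᵐ x, ‖φ x‖ ≤ C) :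
    ∫ s, inner 𝕜 (fracInt β (-e) u s) (φ s) = ∫ s, inner 𝕜 (u s) (fracInt β e φ s) := by
  have hflip : ∫ s, inner 𝕜 (φ s) (fracInt β (-e) u s)
      = (starRingEnd 𝕜) (∫ s, inner 𝕜 (u s) (fracInt β e φ s)) := by
    rw [integral_inner_fracInt hβ hβ1 (neg_ne_zero.2 he) hφ hu hC',
      integral_inner_fracInt hβ hβ1 he hu hφ hC, ← integral_conj]
    congr 1 with t
    rw [← integral_conj, ← integral_sub_right_eq_self _ (e * t)]
    simp only [sub_neg_eq_add, neg_mul, sub_add_cancel, inner_conj_symm]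
  rw [← RCLike.conj_conj (∫ s, inner 𝕜 (u s) _), ← hflip, ← integral_conj]
  simp only [inner_conj_symm]

end Fubini

section Schwartz

open scoped SchwartzMap

variable {β e : ℝ} (u v w : 𝓢(ℝ, ℂ))

theorem integrable_rpow_neg_mul_norm {G : ℝ → ℂ} {C : ℝ} (hβ : 0 ≤ β) (hβ1 : β < 1)
    (hG : Integrable G) (hC : ∀ ξ, ‖G ξ‖ ≤ C) : Integrable fun ξ => |ξ| ^ (-β) * ‖G ξ‖ := by
  have hIoi {f : ℝ → ℂ} (hf : Integrable f) (hfC : ∀ ξ, ‖f ξ‖ ≤ C) :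
      IntegrableOn (fun ξ => |ξ| ^ (-β) * ‖f ξ‖) (Ioi 0) := by
    have h := (integrable_fracMeasure_iff (sub_pos.2 hβ1)).1 (integrable_fracMeasure
      (sub_pos.2 hβ1) (by linarith) hf.norm (C := C) (Eventually.of_forall (by simpa using hfC)))
    refine h.congr_fun (fun ξ (hξ : 0 < ξ) => ?_) measurableSet_Ioi
    simp only [abs_of_pos hξ, smul_eq_mul, sub_sub_cancel_left]
  rw [← integrableOn_univ, ← Iic_union_Ioi (a := (0 : ℝ)), integrableOn_union]
  refine ⟨?_, hIoi hG hC⟩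
  have h := hIoi hG.comp_neg fun ξ => hC (-ξ)
  rw [integrableOn_Iic_iff_integrableOn_Iio, ← (Measure.measurePreserving_neg
    volume).integrableOn_comp_preimage (MeasurableEquiv.neg ℝ).measurableEmbedding]
  simpa [Function.comp_def] using! h

theorem fourier_inner_fourier (h : ℝ) :
    𝓕 (fun ξ => inner ℂ (𝓕 u ξ) (𝓕 w ξ)) h = ∫ s, inner ℂ (u s) (w (s - h)) := by
  have hshift (ξ : ℝ) : 𝓕 (w.compSubConstCLM ℂ h) ξ = Real.fourierChar (-(ξ * h)) • 𝓕 w ξ := by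
    have := congrFun (Fourier.fourierIntegral_comp_add_right Real.fourierChar volume w (-h)) ξ
    simpa [Function.comp_def, ← sub_eq_add_neg, Fourier.fourierIntegral_def, Real.fourier_real_eq,
      SchwartzMap.fourier_coe, mul_comm] using! this
  have hparseval := SchwartzMap.integral_inner_fourier_fourier u (w.compSubConstCLM ℂ h)
  simp only [SchwartzMap.compSubConstCLM_apply] at hparseval
  rw [← hparseval, Real.fourier_real_eq]
  congr 1 with ξ
  rw [hshift, Circle.smul_def, Circle.smul_def, inner_smul_right, smul_eq_mul]

theorem ae_norm_le_norm_toBoundedContinuousFunction :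
    ∀ᵐ x, ‖v x‖ ≤ ‖v.toBoundedContinuousFunction‖ :=
  Eventually.of_forall v.toBoundedContinuousFunction.norm_coe_le_norm

theorem integral_inner_fracInt_eq_integral_fourier (hβ : 0 < β) (hβ1 : β < 1) (he : |e| = 1) :
    ∫ s, inner ℂ (u s) (fracInt β e w s)
      = ∫ ξ, fracSymbol β e ξ * inner ℂ (𝓕 u ξ) (𝓕 w ξ) := by
  have he0 : e ≠ 0 := by rintro rfl; simp at he
  have hw := ae_norm_le_norm_toBoundedContinuousFunction w
  have hcross (ξ : ℝ) : ‖inner ℂ (𝓕 u ξ) (𝓕 w ξ)‖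
      ≤ ‖(𝓕 u).toBoundedContinuousFunction‖ * ‖𝓕 w ξ‖ := by
    refine (norm_inner_le_norm _ _).trans ?_
    gcongr
    exact (𝓕 u).toBoundedContinuousFunction.norm_coe_le_norm ξ
  have hint : Integrable fun ξ => inner ℂ (𝓕 u ξ) (𝓕 w ξ) :=
    ((𝓕 w).integrable.norm.const_mul _).mono'
      ((𝓕 u).continuous.inner (𝓕 w).continuous).aestronglyMeasurable (Eventually.of_forall hcross)
  have hbound (ξ : ℝ) := (hcross ξ).trans (mul_le_mul_of_nonneg_left
    ((𝓕 w).toBoundedContinuousFunction.norm_coe_le_norm ξ) (norm_nonneg _))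
  have hFubini := integrable_prod_inner_fracMeasure (𝕜 := ℂ) hβ hβ1.le he0 u.integrable
    w.integrable hw
  rw [integral_inner_fracInt hβ hβ1.le he0 u.integrable w.integrable hw,
    ← integral_fourier_fracMeasure hβ he hint (integrable_rpow_neg_mul_norm hβ.le hβ1 hint hbound)]
  · simp only [fourier_inner_fourier]
  · simpa only [fourier_inner_fourier] using hFubini.integral_prod_right

theorem inner_fracDeriv_eq_neg_integral (hβ : 0 < β) (hβ1 : β < 1) (he : |e| = 1)
    {g : Lp ℂ 2 (volume : Measure ℝ)} (hg : g =ᵐ[volume] fun ξ => (|ξ| ^ (1 - β) : ℝ) * 𝓕 w ξ) :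
    inner ℂ (v.toLp 2) (fracDeriv β e g) = -∫ s, inner ℂ (deriv v s) (fracInt β e w s) := by
  have hderiv (ξ : ℝ) : 𝓕 (SchwartzMap.derivCLM ℂ ℂ v) ξ = 2 * π * I * ξ * 𝓕 v ξ :=
    congrFun (Real.fourier_deriv v.integrable v.differentiable
      (SchwartzMap.derivCLM ℂ ℂ v).integrable) ξ
  have hmul := integral_inner_fracInt_eq_integral_fourier (SchwartzMap.derivCLM ℂ ℂ v) w hβ hβ1 he
  simp only [SchwartzMap.derivCLM_apply] at hmul
  rw [hmul, ← integral_neg, ← Lp.inner_fourier_eq, SchwartzMap.toLp_fourier_eq, L2.inner_def]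
  refine integral_congr_ae ?_
  filter_upwards [(𝓕 v).coeFn_toLp 2, fourier_fracDeriv g, hg, volume.ae_ne 0] with ξ h1 h2 h3 hξ
  rw [h1, h2, h3, ← mul_assoc, fracDerivSymbol_mul hξ, hderiv, RCLike.inner_apply,
    RCLike.inner_apply]
  simp only [map_mul, map_ofNat, conj_ofReal, conj_I]
  ring

end Schwartz

section SobolevEmbedding

open scoped SchwartzMap

variable {μ : ℝ}

theorem memLp_one_add_abs_rpow_neg (hμ : 1 / 2 < μ) :
    MemLp (fun ξ : ℝ => (1 + |ξ|) ^ (-μ)) 2 volume := by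
  have hmeas : AEStronglyMeasurable (fun ξ : ℝ => (1 + |ξ|) ^ (-μ)) volume :=
    (Measurable.pow_const (by fun_prop) _).aestronglyMeasurable
  rw [memLp_two_iff_integrable_sq hmeas]
  refine (integrable_one_add_norm (r := 2 * μ) (by simp; linarith)).congr
    (Eventually.of_forall fun ξ => ?_)
  simp only [Real.norm_eq_abs]
  rw [← Real.rpow_mul_natCast (by positivity)]
  push_cast
  ring_nf

theorem integral_mul_norm_le_norm_mul_norm {α : Type*} [MeasurableSpace α] {ν : Measure α}
    {E : Type*} [NormedAddCommGroup E] {k : α → ℝ} (hk : MemLp k 2 ν) (g : Lp E 2 ν) :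
    ∫ ξ, k ξ * ‖g ξ‖ ∂ν ≤ ‖hk.toLp‖ * ‖g‖ := by
  have hg := (Lp.memLp g).norm
  have hinner : ∫ ξ, k ξ * ‖g ξ‖ ∂ν = inner ℝ hk.toLp hg.toLp := by
    rw [L2.inner_def]
    refine integral_congr_ae ?_
    filter_upwards [hk.coeFn_toLp, hg.coeFn_toLp] with ξ h1 h2
    rw [h1, h2, Real.inner_apply]
  rw [hinner]
  refine (real_inner_le_norm _ _).trans_eq ?_
  rw [Lp.norm_toLp, Lp.norm_toLp, Lp.norm_def, eLpNorm_norm]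

theorem norm_le_rpow_mul_norm_rpow_mul (hμ : 0 ≤ μ) {δ ξ : ℝ} (hδ : 0 < δ) (hξ : δ ≤ |ξ|)
    (z : ℂ) :
    ‖z‖ ≤ (1 + δ⁻¹) ^ μ * ((1 + |ξ|) ^ (-μ) * ‖(|ξ| ^ μ : ℝ) * z‖) := by
  have hξ0 : 0 < |ξ| := hδ.trans_le hξ
  have hle : 1 + |ξ| ≤ (1 + δ⁻¹) * |ξ| := by
    have h1 : 1 ≤ δ⁻¹ * |ξ| := by rwa [← div_eq_inv_mul, one_le_div hδ]
    linarith
  have hpow : 1 ≤ (1 + δ⁻¹) ^ μ * ((1 + |ξ|) ^ (-μ) * |ξ| ^ μ) := by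
    rw [Real.rpow_neg (by positivity), mul_left_comm, ← Real.mul_rpow (by positivity) hξ0.le,
      ← div_eq_inv_mul, one_le_div (by positivity)]
    exact Real.rpow_le_rpow (by positivity) hle hμ
  rw [norm_mul, norm_real, Real.norm_of_nonneg (by positivity), ← mul_assoc, ← mul_assoc,
    mul_assoc (_ ^ μ)]
  exact le_mul_of_one_le_left (norm_nonneg z) hpow

theorem exists_integral_norm_le (hμ : 1 / 2 < μ) {δ : ℝ} (hδ : 0 < δ) :
    ∃ κ, ∀ {F : ℝ → ℂ} {M : ℝ} {g : Lp ℂ 2 (volume : Measure ℝ)}, (∀ ξ, ‖F ξ‖ ≤ M) →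
      g =ᵐ[volume] (fun ξ => (|ξ| ^ μ : ℝ) * F ξ) → ∫ ξ, ‖F ξ‖ ≤ 2 * δ * M + κ * ‖g‖ := by
  have hk := memLp_one_add_abs_rpow_neg hμ
  refine ⟨(1 + δ⁻¹) ^ μ * ‖hk.toLp‖, fun {F M g} hM hg => ?_⟩
  have hlow : Integrable ((Icc (-δ) δ).indicator fun _ => M) :=
    integrableOn_const (by simp) |>.integrable_indicator measurableSet_Icc
  have hhigh : Integrable fun ξ : ℝ => (1 + δ⁻¹) ^ μ * ((1 + |ξ|) ^ (-μ) * ‖g ξ‖) :=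
    (hk.integrable_mul (Lp.memLp g).norm).const_mul _
  calc ∫ ξ, ‖F ξ‖
      ≤ ∫ ξ, ((Icc (-δ) δ).indicator (fun _ => M) ξ
          + (1 + δ⁻¹) ^ μ * ((1 + |ξ|) ^ (-μ) * ‖g ξ‖)) := by
        refine integral_mono_of_nonneg (Eventually.of_forall fun ξ => norm_nonneg _)
          (hlow.add hhigh) ?_
        filter_upwards [hg] with ξ hξ
        simp only [hξ]
        by_cases h : ξ ∈ Icc (-δ) δ
        · rw [indicator_of_mem h]
          exact le_add_of_le_of_nonneg (hM ξ) (by positivity)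
        · rw [indicator_of_notMem h, zero_add]
          exact norm_le_rpow_mul_norm_rpow_mul (by linarith) hδ
            (not_le.1 fun h' => h (abs_le.1 h')).le (F ξ)
    _ = 2 * δ * M + (1 + δ⁻¹) ^ μ * ∫ ξ, (1 + |ξ|) ^ (-μ) * ‖g ξ‖ := by
        rw [integral_add hlow hhigh, integral_indicator measurableSet_Icc, setIntegral_const,
          integral_const_mul, Real.volume_real_Icc_of_le (by linarith), smul_eq_mul]
        ring
    _ ≤ 2 * δ * M + (1 + δ⁻¹) ^ μ * ‖hk.toLp‖ * ‖g‖ := by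
        rw [mul_assoc ((1 + δ⁻¹) ^ μ)]
        have hCS := integral_mul_norm_le_norm_mul_norm hk g
        gcongr

theorem norm_le_integral_norm_fourier (w : 𝓢(ℝ, ℂ)) (x : ℝ) : ‖w x‖ ≤ ∫ ξ, ‖𝓕 w ξ‖ := by
  have hinv : w x = 𝓕⁻ (𝓕 (w : ℝ → ℂ)) x := by
    have := congrArg (fun f : 𝓢(ℝ, ℂ) => f x)
      (FourierTransform.fourierInv_fourier_eq w : 𝓕⁻ (𝓕 w) = w)
    simpa only [SchwartzMap.fourierInv_coe, SchwartzMap.fourier_coe] using! this.symm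
  rw [hinv, Real.fourierInv_eq_fourier_neg]
  exact VectorFourier.norm_fourierIntegral_le_integral_norm _ _ _ _ _

end SobolevEmbedding

/-- A smooth compactly supported real-valued function, as a complex-valued Schwartz function. -/
def toComplexSchwartz {w : ℝ → ℝ} (hw : ContDiff ℝ ∞ w) (hws : HasCompactSupport w) :
    SchwartzMap ℝ ℂ :=
  (hws.comp_left (g := ofReal) ofReal_zero).toSchwartzMap (ofRealCLM.contDiff.comp hw)

/-- A test function as a complex-valued Schwartz function. -/
abbrev IsTestFunction.toSchwartz {a b : ℝ} {w : ℝ → ℝ} (hw : IsTestFunction a b w) :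
    SchwartzMap ℝ ℂ :=
  toComplexSchwartz hw.smooth hw.hasCompactSupport

theorem IsTestFunction.eq_zero {a b : ℝ} {w : ℝ → ℝ} (hw : IsTestFunction a b w) {x : ℝ}
    (hx : x ∉ Ioo a b) : w x = 0 :=
  image_eq_zero_of_notMem_tsupport fun h => hx (hw.tsupport_subset h)

theorem IsTestFunction.norm_fourier_le {a b M : ℝ} {w : ℝ → ℝ} (hw : IsTestFunction a b w)
    (hM : ∀ x, |w x| ≤ M) (ξ : ℝ) : ‖𝓕 hw.toSchwartz ξ‖ ≤ volume.real (Ioo a b) * M :=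
  calc ‖𝓕 hw.toSchwartz ξ‖ ≤ ∫ x, ‖(w x : ℂ)‖ :=
        VectorFourier.norm_fourierIntegral_le_integral_norm _ _ _ _ _
    _ = ∫ x in Ioo a b, |w x| := by
        rw [setIntegral_eq_integral_of_forall_compl_eq_zero fun _ hx => by simp [hw.eq_zero hx]]
        simp
    _ ≤ ∫ _ in Ioo a b, M :=
        setIntegral_mono (hw.smooth.continuous.integrable_of_hasCompactSupport
          hw.hasCompactSupport).abs.integrableOn (integrableOn_const (by simp)) hM
    _ = volume.real (Ioo a b) * M := setIntegral_const M

/-- The low frequencies contribute at most half of `sup |w|`, which is absorbed on the left. -/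
theorem IsTestFunction.exists_abs_le {μ : ℝ} (hμ : 1 / 2 < μ) (a b : ℝ) :
    ∃ C, ∀ {w : ℝ → ℝ} {g : Lp ℂ 2 (volume : Measure ℝ)}, IsTestFunction a b w →
      g =ᵐ[volume] (fun ξ => (|ξ| ^ μ : ℝ) * 𝓕 (fun x => (w x : ℂ)) ξ) →
      ∀ x, |w x| ≤ C * ‖g‖ := by
  set L := volume.real (Ioo a b)
  have : 0 ≤ L := measureReal_nonneg
  obtain ⟨κ, hκ⟩ := exists_integral_norm_le hμ (δ := (4 * (L + 1))⁻¹) (by positivity)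
  refine ⟨2 * κ, fun {w g} hw hg x => ?_⟩
  obtain ⟨x₀, hx₀⟩ := hw.smooth.continuous.norm.exists_forall_ge_of_hasCompactSupport
    hw.hasCompactSupport.norm
  have hsup : |w x₀| ≤ 2 * (4 * (L + 1))⁻¹ * (L * |w x₀|) + κ * ‖g‖ := by
    refine le_trans ?_ (hκ (hw.norm_fourier_le hx₀) hg)
    rw [← Real.norm_eq_abs, ← Complex.norm_real]
    exact norm_le_integral_norm_fourier hw.toSchwartz x₀
  have hhalf : 2 * (4 * (L + 1))⁻¹ * (L * |w x₀|) ≤ |w x₀| / 2 := by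
    rw [← div_eq_mul_inv, div_mul_eq_mul_div, div_le_iff₀ (by positivity)]
    nlinarith [abs_nonneg (w x₀)]
  exact (hx₀ x).trans (by rw [Real.norm_eq_abs]; linarith)

section HZero

variable {μ a b : ℝ} {p : PairSpaceLine}

theorem HZero.exists_seq (hp : p ∈ HZero μ a b) :
    ∃ q : ℕ → PairSpaceLine, (∀ n, q n ∈ testGraph μ a b) ∧ Tendsto q atTop (𝓝 p) ∧
      ∀ᵐ x, Tendsto (fun n => (q n).fst x) atTop (𝓝 (p.fst x)) := by
  obtain ⟨q, hq, hlim⟩ := mem_closure_iff_seq_limit.1 hp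
  have hfst : Tendsto (fun n => (q n).fst) atTop (𝓝 p.fst) :=
    ((WithLp.continuous_fst 2 _ _).tendsto p).comp hlim
  obtain ⟨ns, hns, hae⟩ := (tendstoInMeasure_of_tendsto_Lp hfst).exists_seq_tendsto_ae
  exact ⟨q ∘ ns, fun n => hq _, hlim.comp hns.tendsto_atTop, hae⟩

theorem HZero.ae_eq_zero (hp : p ∈ HZero μ a b) : ∀ᵐ x, x ∉ Ioo a b → p.fst x = 0 := by
  obtain ⟨q, hq, -, hae⟩ := HZero.exists_seq hp
  have hqn : ∀ᵐ x, ∀ n, x ∉ Ioo a b → (q n).fst x = 0 := by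
    refine ae_all_iff.2 fun n => ?_
    obtain ⟨w, hw, hfst, -⟩ := hq n
    filter_upwards [hfst] with x hx hxab
    rw [hx, hw.eq_zero hxab]
  filter_upwards [hae, hqn] with x hlim hzero hxab
  exact tendsto_nhds_unique hlim (by simp only [hzero _ hxab, tendsto_const_nhds])

theorem HZero.exists_ae_abs_le (hμ : 1 / 2 < μ) (a b : ℝ) :
    ∃ C, 0 ≤ C ∧ ∀ p ∈ HZero μ a b, ∀ᵐ x, |p.fst x| ≤ C * ‖p.snd‖ := by
  obtain ⟨C, hC⟩ := IsTestFunction.exists_abs_le hμ a b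
  refine ⟨|C|, abs_nonneg C, fun p hp => ?_⟩
  obtain ⟨q, hq, hlim, hae⟩ := HZero.exists_seq hp
  have hsnd : Tendsto (fun n => |C| * ‖(q n).snd‖) atTop (𝓝 (|C| * ‖p.snd‖)) :=
    ((((WithLp.continuous_snd 2 _ _).tendsto p).comp hlim).norm).const_mul _
  have hqn : ∀ᵐ x, ∀ n, |(q n).fst x| ≤ |C| * ‖(q n).snd‖ := by
    refine ae_all_iff.2 fun n => ?_
    obtain ⟨w, hw, hfst, hsnd⟩ := hq n
    filter_upwards [hfst] with x hx
    rw [hx]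
    exact (hC hw hsnd x).trans (mul_le_mul_of_nonneg_right (le_abs_self C) (norm_nonneg _))
  filter_upwards [hae, hqn] with x hx hle
  exact le_of_tendsto_of_tendsto' hx.abs hsnd hle

theorem HZero.integrable_fst (hp : p ∈ HZero μ a b) : Integrable p.fst := by
  have hint : IntegrableOn p.fst (Ioo a b) :=
    ((Lp.memLp p.fst).restrict (Ioo a b)).integrable (by norm_num)
  exact hint.integrable_of_ae_notMem_eq_zero (HZero.ae_eq_zero hp)

theorem HZero.exists_norm_fst_le (hμ : 1 / 2 < μ) (a b : ℝ) :
    ∃ C, 0 ≤ C ∧ ∀ p ∈ HZero μ a b, ‖p.fst‖ ≤ C * ‖p.snd‖ := by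
  obtain ⟨C, hC0, hC⟩ := HZero.exists_ae_abs_le hμ a b
  have hind : MemLp ((Ioo a b).indicator fun _ => C) 2 volume :=
    memLp_indicator_const 2 measurableSet_Ioo _ (Or.inr (by simp))
  refine ⟨‖hind.toLp‖, norm_nonneg _, fun p hp => ?_⟩
  rw [mul_comm]
  refine Lp.norm_le_mul_norm_of_ae_le_mul ?_
  filter_upwards [hC p hp, HZero.ae_eq_zero hp, hind.coeFn_toLp] with x hle hzero hx
  rw [hx]
  by_cases hxab : x ∈ Ioo a b
  · rw [indicator_of_mem hxab, Real.norm_of_nonneg hC0, mul_comm]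
    exact hle
  · rw [hzero hxab, norm_zero]
    positivity

end HZero

section WeakFormulation

open scoped SchwartzMap

variable {β a b e : ℝ} {p : PairSpaceLine}

theorem continuous_integral_inner_ofReal {α : Type*} [MeasurableSpace α] {ν : Measure α}
    {u : α → ℂ} (hu : MemLp u 2 ν) :
    Continuous fun f : Lp ℝ 2 ν => ∫ s, inner ℂ (u s) (f s : ℂ) ∂ν := by
  have heq : (fun f : Lp ℝ 2 ν => ∫ s, inner ℂ (u s) (f s : ℂ) ∂ν)
      = fun f => inner ℂ hu.toLp (ofRealCLM.compLpL 2 ν f) := by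
    ext f
    rw [L2.inner_def]
    refine integral_congr_ae ?_
    filter_upwards [hu.coeFn_toLp, ofRealCLM.coeFn_compLpL f] with s h1 h2
    rw [h1, h2, ofRealCLM_apply]
  rw [heq]
  exact continuous_const.inner (ContinuousLinearMap.continuous _)

theorem HZero.integral_indicator_inner_fst {μ : ℝ} (hp : p ∈ HZero μ a b) (u : ℝ → ℂ) :
    ∫ s, inner ℂ ((Ioo a b).indicator u s) (p.fst s : ℂ) = ∫ s, inner ℂ (u s) (p.fst s : ℂ) := by
  refine integral_congr_ae ?_
  filter_upwards [HZero.ae_eq_zero hp] with s hs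
  by_cases h : s ∈ Ioo a b
  · rw [indicator_of_mem h]
  · rw [hs h, ofReal_zero, inner_zero_right, inner_zero_right]

/-- On test functions this is the duality on Schwartz functions; both sides are continuous in
`p`, the right one because the potential of `deriv v` is bounded on `(a, b)`. -/
theorem HZero.inner_fracDeriv_eq_neg_integral_fracInt_inner (hβ : 0 < β) (hβ1 : β < 1)
    (he : |e| = 1) (hp : p ∈ HZero (1 - β) a b) (v : 𝓢(ℝ, ℂ)) :
    inner ℂ (v.toLp 2) (fracDeriv β e p.snd)
      = -∫ s, inner ℂ (fracInt β (-e) (deriv v) s) (p.fst s : ℂ) := by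
  have he0 : e ≠ 0 := by rintro rfl; simp at he
  set v' : 𝓢(ℝ, ℂ) := SchwartzMap.derivCLM ℂ ℂ v
  have hv' : deriv v = v' := rfl
  have hv'_le := ae_norm_le_norm_toBoundedContinuousFunction v'
  have hu : MemLp ((Ioo a b).indicator (fracInt β (-e) v')) 2 volume := by
    rw [memLp_indicator_iff_restrict measurableSet_Ioo]
    exact MemLp.of_bound (aestronglyMeasurable_fracInt v'.integrable.1).restrict
      _ (Eventually.of_forall
        (norm_fracInt_le hβ hβ1.le (neg_ne_zero.2 he0) v'.integrable hv'_le))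
  suffices h : ∀ p ∈ HZero (1 - β) a b, inner ℂ (v.toLp 2) (fracDeriv β e p.snd)
      = -∫ s, inner ℂ ((Ioo a b).indicator (fracInt β (-e) v') s) (p.fst s : ℂ) by
    rw [h p hp, HZero.integral_indicator_inner_fst hp, hv']
  refine fun p hp => closure_minimal (fun q hq => ?_) (isClosed_eq
    (continuous_const.inner ((fracDeriv β e).continuous.comp (WithLp.continuous_snd 2 _ _)))
    ((continuous_integral_inner_ofReal hu).comp (WithLp.continuous_fst 2 _ _)).neg) hp
  obtain ⟨w, hw, hfst, hsnd⟩ := id hq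
  have hduality := inner_fracDeriv_eq_neg_integral v hw.toSchwartz hβ hβ1 he hsnd
  change inner ℂ (v.toLp 2) (fracDeriv β e q.snd)
    = -∫ s, inner ℂ ((Ioo a b).indicator (fracInt β (-e) v') s) (q.fst s : ℂ)
  rw [HZero.integral_indicator_inner_fst (subset_closure hq), hduality, hv',
    ← integral_fracInt_inner hβ hβ1.le he0 v'.integrable hv'_le hw.toSchwartz.integrable
      (ae_norm_le_norm_toBoundedContinuousFunction _)]
  congr 1
  refine integral_congr_ae ?_
  filter_upwards [hfst] with s hs
  rw [hs]
  rfl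

theorem HZero.integral_smul_fracDeriv (hβ : 0 < β) (hβ1 : β < 1 / 2) (he : |e| = 1)
    (hp : p ∈ HZero (1 - β) a b) {v : ℝ → ℝ} (hv : ContDiff ℝ ∞ v) (hvs : HasCompactSupport v) :
    ∫ x, v x • fracDeriv β e p.snd x
      = ((-∫ x, fracInt β e p.fst x * deriv v x : ℝ) : ℂ) := by
  have he0 : e ≠ 0 := by rintro rfl; simp at he
  obtain ⟨C, -, hC⟩ := HZero.exists_ae_abs_le (μ := 1 - β) (by linarith) a b
  have hint : Integrable fun s => (p.fst s : ℂ) := (HZero.integrable_fst hp).ofReal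
  have hle : ∀ᵐ s, ‖(p.fst s : ℂ)‖ ≤ C * ‖p.snd‖ := (hC p hp).mono fun s hs => by simpa using hs
  set V := toComplexSchwartz hv hvs
  have hinner : ∫ x, v x • fracDeriv β e p.snd x = inner ℂ (V.toLp 2) (fracDeriv β e p.snd) := by
    rw [L2.inner_def]
    refine integral_congr_ae ?_
    filter_upwards [V.coeFn_toLp 2] with x hx
    rw [hx, RCLike.inner_apply, real_smul, mul_comm]
    exact congrArg _ (conj_ofReal (v x)).symm
  have hderiv : deriv (V : ℝ → ℂ) = fun x => ((deriv v x : ℝ) : ℂ) := by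
    ext x
    exact ((hv.differentiable (by simp)) x).hasDerivAt.ofReal_comp.deriv
  set V' : 𝓢(ℝ, ℂ) := SchwartzMap.derivCLM ℂ ℂ V
  have hV' : deriv V = V' := rfl
  rw [hinner, HZero.inner_fracDeriv_eq_neg_integral_fracInt_inner hβ (by linarith) he hp V,
    hV', integral_fracInt_inner hβ (by linarith) he0 V'.integrable
      (ae_norm_le_norm_toBoundedContinuousFunction V') hint hle,
    ← hV', hderiv, ofReal_neg, neg_inj]
  refine Eq.trans ?_ integral_ofReal
  congr 1 with x
  rw [fracInt_ofReal]
  simp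

end WeakFormulation

section OneSidedDerivative

variable {β a b e : ℝ} {p : PairSpaceLine}

theorem HZero.integral_mul_re_fracDeriv (hβ : 0 < β) (hβ1 : β < 1 / 2) (he : |e| = 1)
    (hp : p ∈ HZero (1 - β) a b) {v : ℝ → ℝ} (hv : ContDiff ℝ ∞ v) (hvs : HasCompactSupport v) :
    ∫ x, v x * (fracDeriv β e p.snd x).re = -∫ x, fracInt β e p.fst x * deriv v x := by
  have hint : Integrable fun x => v x • fracDeriv β e p.snd x :=
    ((Lp.memLp _).locallyIntegrable (by norm_num)).integrable_smul_left_of_hasCompactSupport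
      hv.continuous hvs
  have h := congrArg Complex.re (HZero.integral_smul_fracDeriv hβ hβ1 he hp hv hvs)
  rw [ofReal_re, ← reCLM_apply, ← reCLM.integral_comp_comm hint] at h
  simpa using h

theorem HZero.ae_im_fracDeriv_eq_zero (hβ : 0 < β) (hβ1 : β < 1 / 2) (he : |e| = 1)
    (hp : p ∈ HZero (1 - β) a b) : ∀ᵐ x, (fracDeriv β e p.snd x).im = 0 := by
  have hD := Lp.memLp (fracDeriv β e p.snd)
  refine ae_eq_zero_of_integral_contDiff_smul_eq_zero
    (hD.im.locallyIntegrable (by norm_num)) fun v hv hvs => ?_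
  have hint : Integrable fun x => v x • fracDeriv β e p.snd x :=
    (hD.locallyIntegrable (by norm_num)).integrable_smul_left_of_hasCompactSupport
      hv.continuous hvs
  have h := congrArg Complex.im (HZero.integral_smul_fracDeriv hβ hβ1 he hp hv hvs)
  rw [ofReal_im, ← imCLM_apply, ← imCLM.integral_comp_comm hint] at h
  simpa using h

theorem HZero.fracInt_eq_zero {μ x : ℝ} (he : e ≠ 0) (hp : p ∈ HZero μ a b)
    (hx : ∀ t > 0, x - e * t ∉ Ioo a b) : fracInt β e p.fst x = 0 := by
  refine integral_eq_zero_of_ae ?_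
  filter_upwards [ae_fracMeasure_pos, fracMeasure_absolutelyContinuous.ae_le
    ((quasiMeasurePreserving_sub_mul he x).ae (HZero.ae_eq_zero hp))] with t ht hzero
  exact hzero (hx t ht)

theorem HZero.ae_fracDeriv_eq_zero_of_isOpen (hβ : 0 < β) (hβ1 : β < 1 / 2) (he : |e| = 1)
    (hp : p ∈ HZero (1 - β) a b) {U : Set ℝ} (hU : IsOpen U)
    (hdisj : ∀ x ∈ U, ∀ t > 0, x - e * t ∉ Ioo a b) :
    ∀ᵐ x, x ∈ U → fracDeriv β e p.snd x = 0 := by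
  have he0 : e ≠ 0 := by rintro rfl; simp at he
  have hD := Lp.memLp (fracDeriv β e p.snd)
  refine hU.ae_eq_zero_of_integral_contDiff_smul_eq_zero
    ((hD.locallyIntegrable (by norm_num)).locallyIntegrableOn U) fun v hv hvs hvU => ?_
  rw [HZero.integral_smul_fracDeriv hβ hβ1 he hp hv hvs, integral_eq_zero_of_ae, neg_zero,
    ofReal_zero]
  refine Eventually.of_forall fun x => show _ * _ = (0 : ℝ) from ?_
  by_cases hx : x ∈ U
  · rw [HZero.fracInt_eq_zero he0 hp (hdisj x hx), zero_mul]
  · rw [image_eq_zero_of_notMem_tsupport (f := deriv v) fun h =>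
      hx (hvU (tsupport_deriv_subset h)), mul_zero]

/-- The derivative of the fractional integral of direction `e` as a real-valued function on
`(a, b)`, in terms of `g = |ξ| ^ (1 - β) 𝓕 φ`. -/
def fracDerivOn (β e a b : ℝ) :
    Lp ℂ 2 (volume : Measure ℝ) →L[ℝ] Lp ℝ 2 (volume.restrict (Ioo a b)) :=
  LpToLpRestrictCLM ℝ ℝ ℝ volume 2 (Ioo a b) ∘L reCLM.compLpL 2 volume ∘L
    (fracDeriv β e).restrictScalars ℝ

theorem coeFn_fracDerivOn (g : Lp ℂ 2 (volume : Measure ℝ)) :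
    fracDerivOn β e a b g =ᵐ[volume.restrict (Ioo a b)] fun x => (fracDeriv β e g x).re := by
  filter_upwards [LpToLpRestrictCLM_coeFn ℝ (Ioo a b) (reCLM.compLpL 2 volume (fracDeriv β e g)),
    ae_restrict_of_ae (reCLM.coeFn_compLpL (fracDeriv β e g))] with x h1 h2
  exact h1.trans h2

theorem norm_fracDerivOn_le (he : |e| = 1) (g : Lp ℂ 2 (volume : Measure ℝ)) :
    ‖fracDerivOn β e a b g‖ ≤ (2 * π) ^ (1 - β) * ‖g‖ :=
  calc ‖fracDerivOn β e a b g‖ ≤ ‖reCLM.compLpL 2 volume (fracDeriv β e g)‖ :=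
        norm_Lp_toLp_restrict_le _ _
    _ ≤ ‖fracDeriv β e g‖ := by
        refine Lp.norm_le_norm_of_ae_le ?_
        filter_upwards [reCLM.coeFn_compLpL (fracDeriv β e g)] with x hx
        rw [hx]
        exact abs_re_le_norm _
    _ ≤ (2 * π) ^ (1 - β) * ‖g‖ := by simpa [he] using norm_fracDeriv_le (β := β) (e := e) g

/-- The derivatives of the left and the right potential live on half-lines that only meet in
`(a, b)`, which therefore carries their whole inner product. -/
theorem HZero.inner_fracDerivOn (hβ : 0 < β) (hβ1 : β < 1 / 2) (hp : p ∈ HZero (1 - β) a b) :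
    inner ℝ (fracDerivOn β 1 a b p.snd) (fracDerivOn β (-1) a b p.snd)
      = Real.cos (π * β) * ((2 * π) ^ (1 - β) * ‖p.snd‖) ^ 2 := by
  have hleft := HZero.ae_fracDeriv_eq_zero_of_isOpen hβ hβ1 abs_one hp isOpen_Iio (U := Iio a)
    fun x hx t ht h => by linarith [h.1, mem_Iio.1 hx]
  have hright := HZero.ae_fracDeriv_eq_zero_of_isOpen hβ hβ1 (e := -1) (by simp) hp isOpen_Ioi
    (U := Ioi b) fun x hx t ht h => by linarith [h.2, mem_Ioi.1 hx]
  have hre := re_inner_fracDeriv (β := β) p.snd one_ne_zero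
  rw [abs_one, Real.one_rpow, mul_one] at hre
  have hsupport : ∀ᵐ x, x ∉ Ioo a b →
      reCLM (inner ℂ (fracDeriv β 1 p.snd x) (fracDeriv β (-1) p.snd x)) = 0 := by
    filter_upwards [hleft, hright, volume.ae_ne a, volume.ae_ne b] with x h1 h2 ha hb hx
    rcases lt_or_gt_of_ne ha with hxa | hxa
    · rw [h1 hxa, inner_zero_left, map_zero]
    · have hxb : b < x := (not_lt.1 fun h => hx ⟨hxa, h⟩).lt_of_ne' hb
      rw [h2 hxb, inner_zero_right, map_zero]
  rw [← hre, L2.inner_def, L2.inner_def, ← reCLM_apply,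
    ← reCLM.integral_comp_comm (L2.integrable_inner _ _),
    ← setIntegral_eq_integral_of_ae_compl_eq_zero hsupport]
  refine integral_congr_ae ?_
  filter_upwards [coeFn_fracDerivOn (β := β) (e := 1) (a := a) (b := b) p.snd,
    coeFn_fracDerivOn (β := β) (e := -1) (a := a) (b := b) p.snd,
    ae_restrict_of_ae (HZero.ae_im_fracDeriv_eq_zero hβ hβ1 abs_one hp)] with x h1 h2 him
  rw [h1, h2, Real.inner_apply, RCLike.inner_apply, reCLM_apply, mul_re]
  simp [him, mul_comm]

end OneSidedDerivative

section KernelOnInterval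

variable {β e : ℝ} {φ : ℝ → ℝ}

theorem measurePreserving_sub_mul (he : |e| = 1) (x : ℝ) :
    MeasurePreserving (fun t : ℝ => x - e * t) := by
  rcases eq_or_eq_neg_of_abs_eq he with rfl | rfl
  · simpa using Measure.measurePreserving_sub_left volume x
  · simpa using measurePreserving_add_left volume x

theorem measurableEmbedding_sub_mul (he : |e| = 1) (x : ℝ) :
    MeasurableEmbedding fun t : ℝ => x - e * t := by
  rcases eq_or_eq_neg_of_abs_eq he with rfl | rfl
  · simpa using! (MeasurableEquiv.subLeft x).measurableEmbedding
  · simpa using! (MeasurableEquiv.addLeft x).measurableEmbedding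

theorem mul_sub_sub_mul (he : |e| = 1) (x t : ℝ) : e * (x - (x - e * t)) = t := by
  rw [sub_sub_cancel, ← mul_assoc, ← abs_mul_abs_self, he, one_mul, one_mul]

theorem preimage_sub_mul (he : |e| = 1) (x : ℝ) :
    (fun t => x - e * t) ⁻¹' {s | 0 < e * (x - s)} = Ioi 0 := by
  ext t
  rw [mem_preimage, mem_ofPred_eq, mul_sub_sub_mul he, mem_Ioi]

theorem rpow_smul_comp_sub_mul (he : |e| = 1) (x : ℝ) {t : ℝ} (ht : t ∈ Ioi 0) :
    t ^ (β - 1) • φ (x - e * t) = φ (x - e * t) / (e * (x - (x - e * t))) ^ (1 - β) := by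
  rw [mul_sub_sub_mul he, div_eq_mul_inv, ← Real.rpow_neg (le_of_lt ht), neg_sub, smul_eq_mul,
    mul_comm]

theorem integrableOn_div_rpow_iff (hβ : 0 < β) (he : |e| = 1) (x : ℝ) :
    IntegrableOn (fun s => φ s / (e * (x - s)) ^ (1 - β)) {s | 0 < e * (x - s)}
      ↔ Integrable (fun t => φ (x - e * t)) (fracMeasure β) := by
  rw [← (measurePreserving_sub_mul he x).integrableOn_comp_preimage
    (measurableEmbedding_sub_mul he x), preimage_sub_mul he, integrable_fracMeasure_iff hβ]
  exact integrableOn_congr_fun (fun t ht => (rpow_smul_comp_sub_mul he x ht).symm) measurableSet_Ioi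

theorem fracInt_eq_setIntegral (hβ : 0 < β) (he : |e| = 1) (x : ℝ) :
    fracInt β e φ x
      = (Real.Gamma β)⁻¹ * ∫ s in {s | 0 < e * (x - s)}, φ s / (e * (x - s)) ^ (1 - β) := by
  have hsubst := (measurePreserving_sub_mul he x).setIntegral_preimage_emb
    (measurableEmbedding_sub_mul he x) (fun s => φ s / (e * (x - s)) ^ (1 - β))
    {s | 0 < e * (x - s)}
  rw [fracInt, integral_fracMeasure hβ, smul_eq_mul, ← hsubst, preimage_sub_mul he]
  congr 1
  exact setIntegral_congr_fun measurableSet_Ioi fun t ht => rpow_smul_comp_sub_mul he x ht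

theorem leftFracInt_eq_fracInt {a x : ℝ} (hβ : 0 < β) (hφ : ∀ᵐ s, s < a → φ s = 0) (hx : a ≤ x) :
    leftFracInt a β φ x = fracInt β 1 φ x := by
  rw [fracInt_eq_setIntegral hβ abs_one, leftFracInt, one_div, intervalIntegral.integral_of_le hx,
    integral_Ioc_eq_integral_Ioo]
  congr 1
  simp only [one_mul, sub_pos]
  refine (setIntegral_eq_of_subset_of_ae_sdiff_eq_zero measurableSet_Iio.nullMeasurableSet
    (fun s hs => hs.2) ?_).symm
  filter_upwards [hφ, volume.ae_ne a] with s hs hsa hsx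
  rw [hs ((not_lt.1 fun h => hsx.2 ⟨h, hsx.1⟩).lt_of_ne hsa), zero_div]

theorem rightFracInt_eq_fracInt {b x : ℝ} (hβ : 0 < β) (hφ : ∀ᵐ s, b < s → φ s = 0) (hx : x ≤ b) :
    rightFracInt b β φ x = fracInt β (-1) φ x := by
  rw [fracInt_eq_setIntegral hβ (by simp), rightFracInt, one_div,
    intervalIntegral.integral_of_le hx]
  congr 1
  simp only [neg_one_mul, neg_sub, sub_pos]
  refine (setIntegral_eq_of_subset_of_ae_sdiff_eq_zero measurableSet_Ioi.nullMeasurableSet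
    (fun s hs => hs.1) ?_).symm
  filter_upwards [hφ] with s hs hsx
  rw [hs (not_le.1 fun h => hsx.2 ⟨hsx.1, h⟩), zero_div]

end KernelOnInterval

section OneSidedOperator

theorem norm_le_norm_fst_add_norm_snd {E F : Type*} [SeminormedAddCommGroup E]
    [SeminormedAddCommGroup F] (x : WithLp 2 (E × F)) : ‖x‖ ≤ ‖x.fst‖ + ‖x.snd‖ := by
  rw [WithLp.prod_norm_eq_of_L2]
  refine Real.sqrt_le_iff.2 ⟨by positivity, ?_⟩
  nlinarith [norm_nonneg x.fst, norm_nonneg x.snd]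

variable {β a b e : ℝ}

theorem HZero.integrable_comp_fracMeasure (hβ : 0 < β) (hβ1 : β < 1 / 2) (he : e ≠ 0)
    (φ : HZero (1 - β) a b) (x : ℝ) :
    Integrable (fun t => HZero.fn φ (x - e * t)) (fracMeasure β) := by
  obtain ⟨C, -, hC⟩ := HZero.exists_ae_abs_le (μ := 1 - β) (by linarith) a b
  exact integrable_fracInt hβ (by linarith) he (HZero.integrable_fst φ.2) (hC φ φ.2) x

theorem HZero.intervalIntegrable_left (hβ : 0 < β) (hβ1 : β < 1 / 2) (φ : HZero (1 - β) a b)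
    {x : ℝ} (hx : a ≤ x) :
    IntervalIntegrable (fun s => HZero.fn φ s / (x - s) ^ (1 - β)) volume a x := by
  have h := (integrableOn_div_rpow_iff hβ abs_one x).2
    (HZero.integrable_comp_fracMeasure hβ hβ1 one_ne_zero φ x)
  simp only [one_mul, sub_pos] at h
  rw [intervalIntegrable_iff_integrableOn_Ioo_of_le hx]
  exact h.mono_set fun s hs => hs.2

theorem HZero.intervalIntegrable_right (hβ : 0 < β) (hβ1 : β < 1 / 2) (φ : HZero (1 - β) a b)
    {x : ℝ} (hx : x ≤ b) :
    IntervalIntegrable (fun s => HZero.fn φ s / (s - x) ^ (1 - β)) volume x b := by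
  have h := (integrableOn_div_rpow_iff hβ (e := -1) (by simp) x).2
    (HZero.integrable_comp_fracMeasure hβ hβ1 (by simp) φ x)
  simp only [neg_one_mul, neg_sub, sub_pos] at h
  rw [intervalIntegrable_iff_integrableOn_Ioc_of_le hx]
  exact h.mono_set fun s hs => hs.1

theorem HZero.fracInt_fn_add (hβ : 0 < β) (hβ1 : β < 1 / 2) (he : e ≠ 0)
    (φ ψ : HZero (1 - β) a b) :
    fracInt β e (HZero.fn (φ + ψ)) = fracInt β e (HZero.fn φ) + fracInt β e (HZero.fn ψ) := by
  have hadd : HZero.fn (φ + ψ) =ᵐ[volume] HZero.fn φ + HZero.fn ψ :=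
    Lp.coeFn_add φ.1.fst ψ.1.fst
  rw [fracInt_congr_ae he hadd]
  ext x
  exact integral_add (HZero.integrable_comp_fracMeasure hβ hβ1 he φ x)
    (HZero.integrable_comp_fracMeasure hβ hβ1 he ψ x)

theorem HZero.fracInt_fn_smul (he : e ≠ 0) (c : ℝ) (φ : HZero (1 - β) a b) :
    fracInt β e (HZero.fn (c • φ)) = c • fracInt β e (HZero.fn φ) := by
  have hsmul : HZero.fn (c • φ) =ᵐ[volume] c • HZero.fn φ := Lp.coeFn_smul c φ.1.fst
  rw [fracInt_congr_ae he hsmul]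
  ext x
  exact integral_smul c _

theorem HZero.exists_abs_fracInt_fn_le (hβ : 0 < β) (hβ1 : β < 1 / 2) (he : |e| = 1) :
    ∃ K, 0 ≤ K ∧ ∀ (φ : HZero (1 - β) a b) x, |fracInt β e (HZero.fn φ) x| ≤ K * ‖φ‖ := by
  have he0 : e ≠ 0 := by rintro rfl; simp at he
  obtain ⟨C, hC0, hC⟩ := HZero.exists_ae_abs_le (μ := 1 - β) (by linarith) a b
  refine ⟨(fracMeasure β).real (Iic 1) * C + (Real.Gamma β)⁻¹ * (C * volume.real (Ioo a b)),
    by positivity, fun φ x => ?_⟩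
  have hle : ∀ᵐ s, ‖HZero.fn φ s‖ ≤ C * ‖φ‖ := (hC φ φ.2).mono fun _ hs =>
    hs.trans (mul_le_mul_of_nonneg_left (WithLp.norm_snd_le _ φ.1) hC0)
  have hL1 : ∫ s, ‖HZero.fn φ s‖ ≤ C * volume.real (Ioo a b) * ‖φ‖ :=
    calc ∫ s, ‖HZero.fn φ s‖ = ∫ s in Ioo a b, ‖HZero.fn φ s‖ :=
          (setIntegral_eq_integral_of_ae_compl_eq_zero ((HZero.ae_eq_zero φ.2).mono
            fun _ hs h => norm_eq_zero.2 (hs h))).symm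
      _ ≤ ∫ _ in Ioo a b, C * ‖φ‖ :=
          integral_mono_ae (HZero.integrable_fst φ.2).norm.integrableOn
            (integrableOn_const (by simp)) (ae_restrict_of_ae hle)
      _ = C * volume.real (Ioo a b) * ‖φ‖ := by
          rw [setIntegral_const, smul_eq_mul]
          ring
  calc |fracInt β e (HZero.fn φ) x|
      ≤ (fracMeasure β).real (Iic 1) * (C * ‖φ‖)
          + (Real.Gamma β)⁻¹ * (|e|⁻¹ * ∫ s, ‖HZero.fn φ s‖) :=
        norm_fracInt_le hβ (by linarith) he0 (HZero.integrable_fst φ.2) hle x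
    _ ≤ (fracMeasure β).real (Iic 1) * (C * ‖φ‖)
          + (Real.Gamma β)⁻¹ * (C * volume.real (Ioo a b) * ‖φ‖) := by
        rw [he, inv_one, one_mul]
        gcongr
    _ = _ := by ring

theorem HZero.memLp_fracInt_fn (hβ : 0 < β) (hβ1 : β < 1 / 2) (he : |e| = 1)
    (φ : HZero (1 - β) a b) :
    MemLp (fracInt β e (HZero.fn φ)) 2 (volume.restrict (Ioo a b)) := by
  obtain ⟨K, -, hK⟩ := HZero.exists_abs_fracInt_fn_le (a := a) (b := b) hβ hβ1 he
  exact MemLp.of_bound (aestronglyMeasurable_fracInt (Lp.aestronglyMeasurable φ.1.fst)).restrict _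
    (Eventually.of_forall (hK φ))

theorem HZero.toLp_fracInt_mem_HOne (hβ : 0 < β) (hβ1 : β < 1 / 2) (he : |e| = 1)
    (φ : HZero (1 - β) a b) :
    WithLp.toLp 2 ((HZero.memLp_fracInt_fn hβ hβ1 he φ).toLp, fracDerivOn β e a b φ.1.snd)
      ∈ HOne a b := by
  intro v hv
  have hweak := HZero.integral_mul_re_fracDeriv hβ hβ1 he φ.2 hv.smooth hv.hasCompactSupport
  have hsupport (f : ℝ → ℝ) : ∀ x ∉ Ioo a b, f x * deriv v x = 0 := fun x hx => by
    rw [image_eq_zero_of_notMem_tsupport fun h =>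
      hx (hv.tsupport_subset (tsupport_deriv_subset h)), mul_zero]
  calc ∫ x in Ioo a b, (HZero.memLp_fracInt_fn hβ hβ1 he φ).toLp _ x * deriv v x
      = ∫ x in Ioo a b, fracInt β e φ.1.fst x * deriv v x := by
        refine integral_congr_ae ?_
        filter_upwards [(HZero.memLp_fracInt_fn hβ hβ1 he φ).coeFn_toLp] with x hx
        rw [hx]
        rfl
    _ = -∫ x, v x * (fracDeriv β e φ.1.snd x).re := by
        rw [hweak, neg_neg, setIntegral_eq_integral_of_forall_compl_eq_zero (hsupport _)]
    _ = -∫ x in Ioo a b, fracDerivOn β e a b φ.1.snd x * v x := by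
        rw [← setIntegral_eq_integral_of_forall_compl_eq_zero (s := Ioo a b)
          fun x hx => by rw [hv.eq_zero hx, zero_mul]]
        congr 1
        refine integral_congr_ae ?_
        filter_upwards [coeFn_fracDerivOn (a := a) (b := b) (β := β) (e := e) φ.1.snd] with x hx
        rw [hx, mul_comm]

theorem HZero.exists_norm_toLp_fracInt_le (hβ : 0 < β) (hβ1 : β < 1 / 2) (he : |e| = 1) :
    ∃ K, ∀ φ : HZero (1 - β) a b, ‖(HZero.memLp_fracInt_fn hβ hβ1 he φ).toLp‖ ≤ K * ‖φ‖ := by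
  obtain ⟨K, hK0, hK⟩ := HZero.exists_abs_fracInt_fn_le (a := a) (b := b) hβ hβ1 he
  refine ⟨measureUnivNNReal (volume.restrict (Ioo a b)) ^ (2 : ℝ≥0∞).toReal⁻¹ * K, fun φ => ?_⟩
  rw [mul_assoc]
  refine Lp.norm_le_of_ae_bound (by positivity) ?_
  filter_upwards [(HZero.memLp_fracInt_fn hβ hβ1 he φ).coeFn_toLp] with x hx
  rw [hx]
  exact hK φ x

/-- The one-sided fractional integral of direction `e` from `H^{1-β}_0(a, b)` to `H¹(a, b)`, paired
with its weak derivative. -/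
def oneSidedFracIntOp (hβ : 0 < β) (hβ1 : β < 1 / 2) (he : |e| = 1) :
    HZero (1 - β) a b →L[ℝ] HOne a b :=
  have he0 : e ≠ 0 := by rintro rfl; simp at he
  LinearMap.mkContinuousOfExistsBound
    { toFun φ := ⟨_, HZero.toLp_fracInt_mem_HOne hβ hβ1 he φ⟩
      map_add' φ ψ := by
        refine Subtype.ext (WithLp.ofLp_injective 2 (Prod.ext ?_ (map_add _ φ.1.snd ψ.1.snd)))
        simp only [HZero.fracInt_fn_add hβ hβ1 he0]
        rfl
      map_smul' c φ := by
        refine Subtype.ext (WithLp.ofLp_injective 2 (Prod.ext ?_ (map_smul _ c φ.1.snd)))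
        simp only [HZero.fracInt_fn_smul he0]
        rfl } <| by
    obtain ⟨K, hK⟩ := HZero.exists_norm_toLp_fracInt_le (a := a) (b := b) hβ hβ1 he
    refine ⟨K + (2 * π) ^ (1 - β), fun φ => ?_⟩
    calc _ ≤ ‖(HZero.memLp_fracInt_fn hβ hβ1 he φ).toLp‖ + ‖fracDerivOn β e a b φ.1.snd‖ :=
          norm_le_norm_fst_add_norm_snd _
      _ ≤ K * ‖φ‖ + (2 * π) ^ (1 - β) * ‖φ‖ := by
          gcongr
          · exact hK φ
          · exact (norm_fracDerivOn_le he _).trans (by gcongr; exact WithLp.norm_snd_le _ φ.1)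
      _ = _ := (add_mul ..).symm

end OneSidedOperator

section TwoSidedOperator

variable {β a b θ : ℝ}

/-- The two-sided fractional integral from `H^{1-β}_0(a, b)` to `H¹(a, b)`. -/
def twoSidedFracIntOp (a b θ : ℝ) (hβ : 0 < β) (hβ1 : β < 1 / 2) :
    HZero (1 - β) a b →L[ℝ] HOne a b :=
  θ • oneSidedFracIntOp (a := a) (b := b) hβ hβ1 abs_one
    + (1 - θ) • oneSidedFracIntOp (a := a) (b := b) (e := -1) hβ hβ1 (by simp)

theorem fn_twoSidedFracIntOp (hβ : 0 < β) (hβ1 : β < 1 / 2) (φ : HZero (1 - β) a b) :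
    HOne.fn (twoSidedFracIntOp a b θ hβ hβ1 φ)
      =ᵐ[volume.restrict (Ioo a b)] twoSidedFracInt a b θ β (HZero.fn φ) := by
  have hL := HZero.memLp_fracInt_fn hβ hβ1 abs_one φ
  have hR := HZero.memLp_fracInt_fn hβ hβ1 (e := -1) (by simp) φ
  have hsum : (θ • hL.toLp + (1 - θ) • hR.toLp : Lp ℝ 2 (volume.restrict (Ioo a b)))
      = MemLp.toLp _ ((hL.const_smul θ).add (hR.const_smul (1 - θ))) := rfl
  have hfst : (twoSidedFracIntOp a b θ hβ hβ1 φ).1.fst = θ • hL.toLp + (1 - θ) • hR.toLp := rfl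
  have h0 : ∀ᵐ s, s ∉ Ioo a b → HZero.fn φ s = 0 := HZero.ae_eq_zero φ.2
  rw [HOne.fn, hfst, hsum]
  refine (MemLp.coeFn_toLp _).trans ?_
  filter_upwards [ae_restrict_mem measurableSet_Ioo] with x hx
  rw [twoSidedFracInt, leftFracInt_eq_fracInt hβ
      (h0.mono fun s hs h => hs fun hmem => h.not_gt hmem.1) hx.1.le,
    rightFracInt_eq_fracInt hβ (h0.mono fun s hs h => hs fun hmem => h.not_gt hmem.2) hx.2.le]
  rfl

theorem mul_le_two_mul_norm_convexCombination {E : Type*} [NormedAddCommGroup E]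
    [InnerProductSpace ℝ E] {u v : E} {c N : ℝ} (hu : ‖u‖ ≤ N) (hv : ‖v‖ ≤ N)
    (huv : c * N ^ 2 ≤ inner ℝ u v) (hθ0 : 0 ≤ θ) (hθ1 : θ ≤ 1) :
    c * N ≤ 2 * ‖θ • u + (1 - θ) • v‖ := by
  rcases ((norm_nonneg u).trans hu).eq_or_lt with rfl | hN
  · rw [mul_zero]
    positivity
  refine le_of_mul_le_mul_right ?_ hN
  calc c * N * N ≤ inner ℝ u v + (θ * ‖u‖ ^ 2 + (1 - θ) * ‖v‖ ^ 2) := by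
        have : 0 ≤ 1 - θ := sub_nonneg.2 hθ1
        have : 0 ≤ θ * ‖u‖ ^ 2 + (1 - θ) * ‖v‖ ^ 2 := by positivity
        linarith
    _ = inner ℝ (θ • u + (1 - θ) • v) (u + v) := by
        simp only [inner_add_left, inner_add_right, real_inner_smul_left,
          real_inner_self_eq_norm_sq, real_inner_comm u v]
        ring
    _ ≤ ‖θ • u + (1 - θ) • v‖ * (N + N) :=
        (real_inner_le_norm _ _).trans <| by
          gcongr
          exact norm_add_le_of_le hu hv
    _ = 2 * ‖θ • u + (1 - θ) • v‖ * N := by ring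

theorem norm_snd_le_norm_twoSidedFracIntOp (hβ : 0 < β) (hβ1 : β < 1 / 2) (hθ0 : 0 ≤ θ)
    (hθ1 : θ ≤ 1) (φ : HZero (1 - β) a b) :
    Real.cos (π * β) * ((2 * π) ^ (1 - β) * ‖φ.1.snd‖)
      ≤ 2 * ‖twoSidedFracIntOp a b θ hβ hβ1 φ‖ :=
  (mul_le_two_mul_norm_convexCombination (norm_fracDerivOn_le abs_one _)
    (norm_fracDerivOn_le (by simp) _) (HZero.inner_fracDerivOn hβ hβ1 φ.2).ge hθ0 hθ1).trans <| by
    gcongr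
    exact WithLp.norm_snd_le _ (twoSidedFracIntOp a b θ hβ hβ1 φ).1

theorem exists_norm_le_twoSidedFracIntOp (hβ : 0 < β) (hβ1 : β < 1 / 2) (hθ0 : 0 ≤ θ)
    (hθ1 : θ ≤ 1) :
    ∃ C : ℝ≥0, ∀ φ, ‖φ‖ ≤ C * ‖twoSidedFracIntOp a b θ hβ hβ1 φ‖ := by
  obtain ⟨K, hK0, hK⟩ := HZero.exists_norm_fst_le (μ := 1 - β) (by linarith) a b
  have hcos : 0 < Real.cos (π * β) :=
    Real.cos_pos_of_mem_Ioo ⟨by nlinarith [Real.pi_pos], by nlinarith [Real.pi_pos]⟩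
  set c := Real.cos (π * β) * (2 * π) ^ (1 - β) with hc
  have hc0 : 0 < c := by positivity
  refine ⟨⟨(K + 1) * (2 / c), by positivity⟩, fun φ => ?_⟩
  have hsnd : ‖φ.1.snd‖ ≤ 2 / c * ‖twoSidedFracIntOp a b θ hβ hβ1 φ‖ := by
    rw [div_mul_eq_mul_div, le_div_iff₀' hc0, hc, mul_assoc]
    exact norm_snd_le_norm_twoSidedFracIntOp hβ hβ1 hθ0 hθ1 φ
  calc ‖φ‖ ≤ ‖φ.1.fst‖ + ‖φ.1.snd‖ := norm_le_norm_fst_add_norm_snd φ.1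
    _ ≤ (K + 1) * ‖φ.1.snd‖ := by linarith [hK φ φ.2]
    _ ≤ (K + 1) * (2 / c * ‖twoSidedFracIntOp a b θ hβ hβ1 φ‖) := by gcongr
    _ = _ := (mul_assoc ..).symm

end TwoSidedOperator

section Range

variable {β a b θ : ℝ}

theorem HOne.ext_of_fn {w z : HOne a b} (h : HOne.fn w =ᵐ[volume.restrict (Ioo a b)] HOne.fn z) :
    w = z := by
  suffices hsnd : (w - z).1.snd = 0 from
    Subtype.ext (WithLp.ofLp_injective 2 (Prod.ext (Lp.ext h) (sub_eq_zero.1 hsnd)))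
  have hfst : (w - z).1.fst = 0 := sub_eq_zero.2 (Lp.ext h)
  have hweak : ∀ v, IsTestFunction a b v → ∫ x in Ioo a b, (w - z).1.snd x * v x = 0 := by
    intro v hv
    rw [← neg_eq_zero, ← (w - z).2 v hv, hfst]
    exact integral_eq_zero_of_ae ((Lp.coeFn_zero ℝ 2 _).mono fun x hx => by
      simp only [hx, Pi.zero_apply, zero_mul])
  refine Lp.ext (Filter.EventuallyEq.trans ?_ (Lp.coeFn_zero ℝ 2 _).symm)
  refine (ae_restrict_iff' measurableSet_Ioo).2 <|
    isOpen_Ioo.ae_eq_zero_of_integral_contDiff_smul_eq_zero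
      (IntegrableOn.locallyIntegrableOn ((Lp.memLp _).integrable one_le_two)) fun v hv hvs hvU => ?_
  have htest : IsTestFunction a b v := ⟨hv, hvs, hvU⟩
  rw [← setIntegral_eq_integral_of_forall_compl_eq_zero (s := Ioo a b)
    fun x hx => by rw [htest.eq_zero hx, zero_smul], ← hweak v htest]
  simp only [smul_eq_mul, mul_comm]

/-- The range of the two-sided fractional integral in `H¹(a, b)`; for `(a, b) = (0, 1)` it is
`fracIntRange β θ`. -/
def twoSidedRange (a b β θ : ℝ) : Set (HOne a b) :=
  {w | ∃ φ : HZero (1 - β) a b,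
    HOne.fn w =ᵐ[volume.restrict (Ioo a b)] twoSidedFracInt a b θ β (HZero.fn φ)}

theorem range_twoSidedFracIntOp (hβ : 0 < β) (hβ1 : β < 1 / 2) :
    range (twoSidedFracIntOp a b θ hβ hβ1) = twoSidedRange a b β θ := by
  ext w
  constructor
  · rintro ⟨φ, rfl⟩
    exact ⟨φ, fn_twoSidedFracIntOp hβ hβ1 φ⟩
  · rintro ⟨φ, hφ⟩
    exact ⟨φ, HOne.ext_of_fn ((fn_twoSidedFracIntOp hβ hβ1 φ).trans hφ.symm)⟩

instance HZero.instCompleteSpace {μ a b : ℝ} : CompleteSpace (HZero μ a b) :=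
  (testGraph μ a b).isClosed_topologicalClosure.completeSpace_coe

theorem exists_continuousLinearEquiv_range {E F : Type*} [NormedAddCommGroup E] [NormedSpace ℝ E]
    [NormedAddCommGroup F] [NormedSpace ℝ F] {T : E →L[ℝ] F} {C : ℝ}
    (hinj : Function.Injective T) (hT : ∀ x, ‖x‖ ≤ C * ‖T x‖) :
    ∃ e : E ≃L[ℝ] LinearMap.range T.toLinearMap, ∀ x, (e x : F) = T x := by
  refine ⟨(LinearEquiv.ofInjective T.toLinearMap hinj).toContinuousLinearEquivOfBounds ‖T‖ C
    T.le_opNorm fun y => ?_, fun x => rfl⟩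
  obtain ⟨x, rfl⟩ := (LinearEquiv.ofInjective T.toLinearMap hinj).surjective y
  rw [LinearEquiv.symm_apply_apply]
  exact hT x

theorem theorem4p1_general (a b β θ : ℝ) (hβ0 : 0 < β) (hβ1 : β < 1 / 2) (hθ0 : 0 ≤ θ)
    (hθ1 : θ ≤ 1) :
    (∀ φ : HZero (1 - β) a b, ∀ x ∈ Icc a b,
      IntervalIntegrable (fun s => HZero.fn φ s / (x - s) ^ (1 - β)) volume a x ∧
      IntervalIntegrable (fun s => HZero.fn φ s / (s - x) ^ (1 - β)) volume x b) ∧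
    ∃ T : HZero (1 - β) a b →L[ℝ] HOne a b,
      (∀ φ, HOne.fn (T φ) =ᵐ[volume.restrict (Ioo a b)]
        twoSidedFracInt a b θ β (HZero.fn φ)) ∧
      BijOn T univ (twoSidedRange a b β θ) ∧
      IsClosed (twoSidedRange a b β θ) ∧
      ∃ e : HZero (1 - β) a b ≃L[ℝ] LinearMap.range T.toLinearMap,
        ∀ φ, (e φ : HOne a b) = T φ := by
  set T := twoSidedFracIntOp a b θ hβ0 hβ1
  obtain ⟨C, hC⟩ := exists_norm_le_twoSidedFracIntOp (a := a) (b := b) hβ0 hβ1 hθ0 hθ1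
  have hanti : AntilipschitzWith C T := T.antilipschitz_of_bound hC
  rw [← range_twoSidedFracIntOp hβ0 hβ1, ← image_univ]
  refine ⟨fun φ x hx => ⟨HZero.intervalIntegrable_left hβ0 hβ1 φ hx.1,
    HZero.intervalIntegrable_right hβ0 hβ1 φ hx.2⟩, T, fn_twoSidedFracIntOp hβ0 hβ1,
    hanti.injective.injOn.bijOn_image, ?_, exists_continuousLinearEquiv_range hanti.injective hC⟩
  rw [image_univ]
  exact hanti.isClosed_range T.uniformContinuous

end Range

end

theorem theorem4p1 (β θ : ℝ) (hβ0 : 0 < β) (hβ1 : β < 1 / 2) (hθ0 : 0 ≤ θ) (hθ1 : θ ≤ 1) :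
    -- the integrals converge
    (∀ φ : HZero (1 - β) 0 1, ∀ x ∈ Set.Icc (0 : ℝ) 1,
      IntervalIntegrable (fun s => HZero.fn φ s / (x - s) ^ (1 - β)) volume 0 x ∧
      IntervalIntegrable (fun s => HZero.fn φ s / (s - x) ^ (1 - β)) volume x 1) ∧
    -- the operator is bounded and linear into `H¹(0, 1)`, a bijection onto its closed range, and
    -- a homeomorphism onto it
    ∃ T : HZero (1 - β) 0 1 →L[ℝ] HOne 0 1,
      (∀ φ, HOne.fn (T φ) =ᵐ[volume.restrict (Set.Ioo (0 : ℝ) 1)]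
        twoSidedFracInt 0 1 θ β (HZero.fn φ)) ∧
      Set.BijOn T Set.univ (fracIntRange β θ) ∧
      IsClosed (fracIntRange β θ) ∧
      ∃ e : HZero (1 - β) 0 1 ≃L[ℝ] LinearMap.range T.toLinearMap,
        ∀ φ, (e φ : HOne 0 1) = T φ :=
  theorem4p1_general 0 1 β θ hβ0 hβ1 hθ0 hθ1
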